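/- Let $A,B:\mathbb R\to\mathbb R$ be the homeomorphisms $A(x)=x-1$ and $B(x)=x$ for $x\le 0$, $B(x)=x/2$ for $0\le x\le 2$, $B(x)=x-1$ for $x\ge 2$. Let $\widetilde F$ be the group generated by $A$ and $B$ (a realization of Thompson's group $F$ by piecewise linear homeomorphisms of the line), with the multiplication $(g_1g_2)(x)=g_2(g_1(x))$. It acts on the right on the set $\mathbb Z[\tfrac12]$ of dyadic rationals by $\gamma.g=g(\gamma)$. Let $\Gamma$ be the Schreier graph of this action with respect to $\{A,B,A^{-1},B^{-1}\}$ (with vertex set $\mathbb Z[\tfrac12]$), and let $\partial\Gamma$ be its space of ends, with its usual topology and Borel $\sigma$-algebra. The space $\mathrm{Fun}(\Gamma,\partial\Gamma)=(\partial\Gamma)^\Gamma$ carries the product $\sigma$-algebra and the left action $(g\varphi)(\gamma)=\varphi(\gamma.g)$ of $\widetilde F$. For a probability measure $\mu$ on a countable group $G$, let $\mathbf P$ be the distribution on the path space $G^{\{0,1,2,\dots\}}$ of the random walk $g_n=h_1h_2\cdots h_n$, $g_0=e$, with independent $\mu$-distributed increments $h_i$, and let $\mathbf P_\#$ be the corresponding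 $\sigma$-finite measure with the counting measure on $G$ as initial distribution. The Poisson boundary is the space of ergodic components of the time shift on the path space with respect to $\mathbf P_\#$ (equivalently, the path space with the $\sigma$-algebra of shift-invariant sets, modulo $\mathbf P_\#$-null sets), with the $G$-action induced by left translation of paths and the harmonic measure $\nu$, the image of $\mathbf P$. A $\mu$-boundary is a standard Borel $G$-space $B$ with a probability measure $\lambda$ which is a $G$-equivariant measurable quotient of the Poisson boundary, $\lambda$ being the image of $\nu$; it is non-trivial if $\lambda$ is not a point measure. **Theorem.** Let $\mu$ be a finitely supported probability measure on $\widetilde F$ which is strictly non-degenerate, i.e. the semigroup generated by the support of $\mu$ is the whole of $\widetilde F$. Then for $\mathbf P$-almost every sample path $\boldsymbol g=(g_n)$ and every $\gamma\in\Gamma$ the sequence $\gamma.g_n$ converges to a (unique) end $\omega_\gamma=\omega_\gamma(\boldsymbol g)\in\partial\Gamma$. This gives rise to a measurable map $\boldsymbol g\mapsto(\omega_\gamma)_{\gamma\in\Gamma}\in\mathrm{Fun}(\Gamma,\partial\Gamma)$, defined $\mathbf P$-almost everywhere, and the space $\mathrm{Fun}(\Gamma,\partial\Gamma)$ endowed with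 the image $\lambda$ of $\mathbf P$ under this map is a non-trivial $\mu$-boundary. -/

import Mathlib

open MeasureTheory Filter Topology

noncomputable section

/-! ### The group `F̃` of piecewise linear homeomorphisms of the line -/

/-- The translation `x ↦ x - 1` of the real line. -/
def thompsonA : ℝ ≃ₜ ℝ := Homeomorph.subRight 1

/-- The homeomorphism of the line equal to `x` for `x ≤ 0`, to `x / 2` for `0 ≤ x ≤ 2`, and to
`x - 1` for `2 ≤ x`. -/
def thompsonB : ℝ ≃ₜ ℝ where
  toFun x := if x ≤ 0 then x else if x ≤ 2 then x / 2 else x - 1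
  invFun x := if x ≤ 0 then x else if x ≤ 1 then 2 * x else x + 1
  left_inv x := by
    dsimp only
    split_ifs <;> linarith
  right_inv x := by
    dsimp only
    split_ifs <;> linarith
  continuous_toFun := by
    refine Continuous.if_le continuous_id ?_ continuous_id continuous_const ?_
    · refine Continuous.if_le (by fun_prop) (by fun_prop) continuous_id continuous_const ?_
      rintro x rfl
      norm_num
    · rintro x rfl
      norm_num
  continuous_invFun := by
    refine Continuous.if_le continuous_id ?_ continuous_id continuous_const ?_
    · refine Continuous.if_le (by fun_prop) (by fun_prop) continuous_id continuous_const ?_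
      rintro x rfl
      norm_num
    · rintro x rfl
      norm_num

/-- Thompson's group in its realization on the real line: the group of homeomorphisms generated by
`thompsonA` and `thompsonB`. The multiplication is in postfix notation, that is, `g₁ g₂` is the map
`x ↦ g₂ (g₁ x)`; this is the opposite of the multiplication of `ℝ ≃ₜ ℝ`. -/
def thompsonSubgroup : Subgroup (ℝ ≃ₜ ℝ)ᵐᵒᵖ :=
  Subgroup.closure {MulOpposite.op thompsonA, MulOpposite.op thompsonB}

/-- The group `F̃`. -/
abbrev ThompsonF : Type := thompsonSubgroup

/-- The countable group `F̃` carries the discrete σ-algebra. -/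
instance ThompsonF.instMeasurableSpace : MeasurableSpace ThompsonF := ⊤

/-- The generator `A` as an element of `F̃`. -/
def ThompsonF.A : ThompsonF :=
  ⟨MulOpposite.op thompsonA, Subgroup.subset_closure (by simp)⟩

/-- The generator `B` as an element of `F̃`. -/
def ThompsonF.B : ThompsonF :=
  ⟨MulOpposite.op thompsonB, Subgroup.subset_closure (by simp)⟩

/-! ### The dyadic Schreier graph -/

/-- The set `ℤ[1/2]` of dyadic rational numbers on the real line. -/
def dyadicLine : Set ℝ := {x | ∃ (k : ℤ) (n : ℕ), x = k / 2 ^ n}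

theorem dyadicLine_sub_one {x : ℝ} (hx : x ∈ dyadicLine) : x - 1 ∈ dyadicLine := by
  obtain ⟨k, n, rfl⟩ := hx
  exact ⟨k - 2 ^ n, n, by push_cast; field_simp⟩

theorem dyadicLine_add_one {x : ℝ} (hx : x ∈ dyadicLine) : x + 1 ∈ dyadicLine := by
  obtain ⟨k, n, rfl⟩ := hx
  exact ⟨k + 2 ^ n, n, by push_cast; field_simp⟩

theorem dyadicLine_half {x : ℝ} (hx : x ∈ dyadicLine) : x / 2 ∈ dyadicLine := by
  obtain ⟨k, n, rfl⟩ := hx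
  exact ⟨k, n + 1, by rw [pow_succ]; field_simp⟩

theorem dyadicLine_double {x : ℝ} (hx : x ∈ dyadicLine) : 2 * x ∈ dyadicLine := by
  obtain ⟨k, n, rfl⟩ := hx
  exact ⟨2 * k, n, by push_cast; ring⟩

/-- The group `F̃` preserves the set of dyadic rationals. -/
theorem thompson_mem_dyadicLine (g : ThompsonF) {x : ℝ} (hx : x ∈ dyadicLine) :
    (MulOpposite.unop g.1) x ∈ dyadicLine := by
  obtain ⟨g, hg⟩ := g
  suffices h : ∀ y ∈ dyadicLine,
      (MulOpposite.unop g) y ∈ dyadicLine ∧ (MulOpposite.unop g).symm y ∈ dyadicLine from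
    (h x hx).1
  induction hg using Subgroup.closure_induction with
  | mem g hg =>
    intro y hy
    rcases hg with rfl | hg
    · exact ⟨dyadicLine_sub_one hy, dyadicLine_add_one hy⟩
    · rw [Set.mem_singleton_iff] at hg
      subst hg
      constructor
      · change (if y ≤ 0 then y else if y ≤ 2 then y / 2 else y - 1) ∈ dyadicLine
        split_ifs
        exacts [hy, dyadicLine_half hy, dyadicLine_sub_one hy]
      · change (if y ≤ 0 then y else if y ≤ 1 then 2 * y else y + 1) ∈ dyadicLine
        split_ifs
        exacts [hy, dyadicLine_double hy, dyadicLine_add_one hy]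
  | one => exact fun y hy => ⟨hy, hy⟩
  | mul a b _ _ ha hb => exact fun y hy => ⟨(hb _ (ha y hy).1).1, (ha _ (hb y hy).2).2⟩
  | inv a _ ha => exact fun y hy => ⟨(ha y hy).2, (ha y hy).1⟩

/-- The vertex set of the Schreier graph: the dyadic rationals. -/
abbrev DyadicVertex : Type := dyadicLine

/-- The right action `γ.g = g(γ)` of `F̃` on the dyadic rationals. -/
def DyadicVertex.act (γ : DyadicVertex) (g : ThompsonF) : DyadicVertex :=
  ⟨(MulOpposite.unop g.1) γ.1, thompson_mem_dyadicLine g γ.2⟩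

theorem DyadicVertex.act_one (γ : DyadicVertex) : γ.act 1 = γ := rfl

theorem DyadicVertex.act_mul (γ : DyadicVertex) (g h : ThompsonF) :
    γ.act (g * h) = (γ.act g).act h := rfl

/-- The Schreier graph of the action of `F̃` on the dyadic rationals with respect to the generating
set `{A, B, A⁻¹, B⁻¹}`. Labels, loops and multiple edges are forgotten, as they affect neither the
ends of the graph nor the convergence to them. -/
def dyadicSchreierGraph : SimpleGraph DyadicVertex :=
  SimpleGraph.fromRel fun γ γ' =>
    ∃ s ∈ ({ThompsonF.A, ThompsonF.B, ThompsonF.A⁻¹, ThompsonF.B⁻¹} : Set ThompsonF), γ.act s = γ'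

/-! ### Ends of graphs -/

/-- The space of ends of a graph: coherent choices, for all finite sets `K` of vertices, of a
connected component of the complement of `K`. -/
def EndSpace {V : Type} (G : SimpleGraph V) : Type := G.end

/-- The component of the complement of the finite set `K` chosen by an end. -/
def EndSpace.component {V : Type} {G : SimpleGraph V} (ω : EndSpace G) (K : Finset V) :
    G.ComponentCompl (K : Set V) :=
  ω.1 (Opposite.op K)

/-- The topology of the space of ends: the projective limit of discrete spaces. -/
instance EndSpace.instTopologicalSpace {V : Type} (G : SimpleGraph V) :
    TopologicalSpace (EndSpace G) :=
  TopologicalSpace.induced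
    (fun (ω : EndSpace G) (K : Finset V) => ω.component K)
    (@Pi.topologicalSpace (Finset V) (fun K => G.ComponentCompl (K : Set V)) (fun _ => ⊥))

/-- The Borel σ-algebra of the space of ends. -/
instance EndSpace.instMeasurableSpace {V : Type} (G : SimpleGraph V) :
    MeasurableSpace (EndSpace G) := borel _

/-- Convergence of a sequence of vertices to an end (in the end compactification): for any finite
set `K` of vertices the sequence eventually stays in the component of the complement of `K` chosen
by the end. -/
def ConvergesToEnd {V : Type} (G : SimpleGraph V) (x : ℕ → V) (ω : EndSpace G) : Prop :=
  ∀ K : Finset V, ∀ᶠ n in atTop, x n ∈ ω.component K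

/-! ### End fields -/

/-- The space `Fun(Γ, ∂Γ)` of end fields on the dyadic Schreier graph `Γ`. -/
def EndField : Type := DyadicVertex → EndSpace dyadicSchreierGraph

/-- The product σ-algebra. -/
instance EndField.instMeasurableSpace : MeasurableSpace EndField := MeasurableSpace.pi

/-- The left action of `F̃` on end fields, `(g • φ)(γ) = φ(γ.g)`. -/
instance EndField.instMulAction : MulAction ThompsonF EndField where
  smul g φ := fun γ => φ (γ.act g)
  one_smul _ := rfl
  mul_smul _ _ _ := rfl

/-! ### Random walks, the Poisson boundary and `μ`-boundaries -/

/-- The path with starting point `g` and increments `h 0, h 1, …`: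
`g, g * h 0, g * h 0 * h 1, …`. -/
def walkPath {G : Type} [Group G] (g : G) (h : ℕ → G) : ℕ → G
  | 0 => g
  | n + 1 => walkPath g h n * h n

/-- The distribution on the path space of the random walk with step distribution `μ` started
at `g`. -/
def pathMeasureFrom {G : Type} [Group G] [MeasurableSpace G] (μ : PMF G) (g : G) :
    Measure (ℕ → G) :=
  (Measure.infinitePi fun _ : ℕ => μ.toMeasure).map (walkPath g)

/-- The measure `P` on the path space: the random walk is started at the identity. -/
def pathMeasure {G : Type} [Group G] [MeasurableSpace G] (μ : PMF G) : Measure (ℕ → G) :=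
  pathMeasureFrom μ 1

/-- The measure `P_#` on the path space whose initial distribution is the counting measure. -/
def countingPathMeasure {G : Type} [Group G] [MeasurableSpace G] (μ : PMF G) : Measure (ℕ → G) :=
  Measure.sum fun g => pathMeasureFrom μ g

/-- The time shift on the path space. -/
def timeShift {G : Type} (x : ℕ → G) : ℕ → G := fun n => x (n + 1)

/-- The Poisson boundary, that is, the space of ergodic components of the time shift. It is an
object of the measure category, and is realized here by the path space endowed with the σ-algebra of
shift invariant measurable sets. The null sets are those of the measure `poissonCountingMeasure`
below. -/
def PoissonBoundary (G : Type) : Type := ℕ → G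

instance PoissonBoundary.instMeasurableSpace {G : Type} [MeasurableSpace G] :
    MeasurableSpace (PoissonBoundary G) :=
  MeasurableSpace.invariants (α := ℕ → G) timeShift

/-- The quotient map from the path space to the Poisson boundary. -/
def toPoissonBoundary {G : Type} (x : ℕ → G) : PoissonBoundary G := x

/-- The action of the group on the Poisson boundary, induced by the coordinate-wise left
translations of paths. -/
instance PoissonBoundary.instMulAction {G : Type} [Group G] :
    MulAction G (PoissonBoundary G) where
  smul g x := fun n => g * x n
  one_smul x := funext fun n => one_mul (x n)
  mul_smul g h x := funext fun n => mul_assoc g h (x n)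

/-- The harmonic measure `ν` on the Poisson boundary: the image of `P`. -/
def harmonicMeasure {G : Type} [Group G] [MeasurableSpace G] (μ : PMF G) :
    Measure (PoissonBoundary G) :=
  (pathMeasure μ).map toPoissonBoundary

/-- The image of `P_#` on the Poisson boundary; only its null sets matter. -/
def poissonCountingMeasure {G : Type} [Group G] [MeasurableSpace G] (μ : PMF G) :
    Measure (PoissonBoundary G) :=
  (countingPathMeasure μ).map toPoissonBoundary

/-- A `G`-space `B` with a measure `lam` is a `μ`-boundary if it is an equivariant measurable
quotient of the Poisson boundary endowed with the harmonic measure. -/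
structure IsMuBoundary {G : Type} [Group G] [MeasurableSpace G] (μ : PMF G)
    {B : Type} [MeasurableSpace B] [MulAction G B] (lam : Measure B) : Prop where
  standardBorel : StandardBorelSpace B
  measurable_smul : ∀ g : G, Measurable fun b : B => g • b
  exists_quotient : ∃ p : PoissonBoundary G → B, Measurable p ∧
    (∀ g : G, ∀ᵐ ξ ∂(poissonCountingMeasure μ), p (g • ξ) = g • p ξ) ∧
    (harmonicMeasure μ).map p = lam

/-- A measure is a point measure if it is the unit mass at some point. -/
def IsPointMeasure {B : Type} [MeasurableSpace B] (lam : Measure B) : Prop :=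
  ∃ b : B, lam = Measure.dirac b

/-- A probability measure `μ` is strictly non-degenerate if the semigroup generated by its support
is the whole group. -/
def StrictlyNondegenerate {G : Type} [Group G] (μ : PMF G) : Prop :=
  Subsemigroup.closure μ.support = ⊤

end

noncomputable section

/-! ### The Koopman representation on the square summable functions -/

/-! The argument rests on a Dirichlet form estimate. The maps x ↦ x/2 and x ↦ (x+1)/2, induced by
`B` and `A⁻¹B` on U = (0,1) ∩ ℤ[1/2], have disjoint images in U. A function in ℓ² almost invariant
under both would carry its mass over U almost twice inside U, so this mass is at most a constant
times the energy of f (`tsum_unitDyadics_sq_le`). Since the support of μ generates the group as a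
semigroup, and each point can be moved into U, the energy also controls every value f(γ)²
(`exists_sq_apply_le`).

Applied to the truncated Green functions G_N = ∑_{n<N} Pⁿδ_x, of energy at most 2 G_N(x), this
bounds their energies uniformly in N. Hence the induced walks are transient, and the Green function
is square summable over U, so it tends to 0 at infinity in U. Symmetry of μ plays no role.

Convergence: for a finite vertex set K, a step from the finite support of μ changes the component of
the complement of K only from finitely many points. A transient walk eventually avoids them, so it
settles in one component. The limit field is shift invariant and equivariant, hence a quotient of
the Poisson boundary.

Non-triviality: if the limit field is almost surely a fixed φ, the Markov property makes φ
invariant, and transitivity makes it a constant end ω. But 1/2 is a cut vertex, and both sides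
contain infinitely many points of U. From far points of U the Green function is small, so with
positive probability the walk never meets the finitely many points where it could change sides
(`finite_pathMeasure_avoid_eq_zero`). Thus ω would lie on both sides. -/

/-- The permutation of the dyadic rationals given by an element of `F̃`. -/
def DyadicVertex.actEquiv (g : ThompsonF) : DyadicVertex ≃ DyadicVertex where
  toFun γ := γ.act g
  invFun γ := γ.act g⁻¹
  left_inv γ := by simp only [← DyadicVertex.act_mul, mul_inv_cancel, DyadicVertex.act_one]
  right_inv γ := by simp only [← DyadicVertex.act_mul, inv_mul_cancel, DyadicVertex.act_one]

@[simp]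
theorem DyadicVertex.actEquiv_apply (g : ThompsonF) (γ : DyadicVertex) :
    DyadicVertex.actEquiv g γ = γ.act g := rfl

/-- The Hilbert space of square summable functions on the dyadic rationals. -/
abbrev DyadicL2 : Type := lp (fun _ : DyadicVertex => ℝ) 2

theorem DyadicL2.summable_sq (f : DyadicL2) : Summable fun γ => f γ ^ 2 := by
  have h := (memℓp_gen_iff (p := 2) (by norm_num)).1 f.2
  simpa using h

theorem DyadicL2.norm_sq_eq (f : DyadicL2) : ‖f‖ ^ 2 = ∑' γ, f γ ^ 2 := by
  have h := lp.norm_rpow_eq_tsum (p := 2) (by norm_num) f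
  simpa using h

theorem DyadicL2.sq_apply_le (f : DyadicL2) (γ : DyadicVertex) : f γ ^ 2 ≤ ‖f‖ ^ 2 := by
  rw [f.norm_sq_eq]
  exact f.summable_sq.le_tsum γ fun _ _ => sq_nonneg _

/-- The unitary operator `(π(g) f)(γ) = f(γ.g)`. -/
def koopman (g : ThompsonF) : DyadicL2 →ₗᵢ[ℝ] DyadicL2 where
  toFun f := ⟨fun γ => f (γ.act g), by
    refine (memℓp_gen_iff (p := 2) (by norm_num)).2 ?_
    have := (DyadicVertex.actEquiv g).summable_iff.2 f.summable_sq
    simpa [Function.comp_def] using this⟩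
  map_add' _ _ := rfl
  map_smul' _ _ := rfl
  norm_map' f := by
    rw [← sq_eq_sq₀ (norm_nonneg _) (norm_nonneg _), DyadicL2.norm_sq_eq, DyadicL2.norm_sq_eq]
    exact (DyadicVertex.actEquiv g).tsum_eq fun γ => f γ ^ 2

@[simp]
theorem koopman_apply (g : ThompsonF) (f : DyadicL2) (γ : DyadicVertex) :
    koopman g f γ = f (γ.act g) := rfl

theorem koopman_mul (g h : ThompsonF) (f : DyadicL2) :
    koopman (g * h) f = koopman g (koopman h f) := rfl

/-! ### A spectral gap over the unit interval -/

/-- The dyadic rationals in the open unit interval. -/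
def unitDyadics : Set DyadicVertex := {γ | 0 < γ.1 ∧ γ.1 < 1}

theorem DyadicVertex.coe_act_A (γ : DyadicVertex) : (γ.act ThompsonF.A).1 = γ.1 - 1 := rfl

theorem DyadicVertex.coe_act_A_inv (γ : DyadicVertex) : (γ.act ThompsonF.A⁻¹).1 = γ.1 + 1 := rfl

theorem DyadicVertex.coe_act_B (γ : DyadicVertex) : (γ.act ThompsonF.B).1 =
    if γ.1 ≤ 0 then γ.1 else if γ.1 ≤ 2 then γ.1 / 2 else γ.1 - 1 := rfl

theorem coe_act_B_of_mem {γ : DyadicVertex} (h : γ ∈ unitDyadics) :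
    (γ.act ThompsonF.B).1 = γ.1 / 2 := by
  obtain ⟨h0, h1⟩ := h
  rw [DyadicVertex.coe_act_B, if_neg (by linarith), if_pos (by linarith)]

theorem coe_act_A_inv_mul_B_of_mem {γ : DyadicVertex} (h : γ ∈ unitDyadics) :
    (γ.act (ThompsonF.A⁻¹ * ThompsonF.B)).1 = (γ.1 + 1) / 2 := by
  obtain ⟨h0, h1⟩ := h
  rw [DyadicVertex.act_mul, DyadicVertex.coe_act_B, DyadicVertex.coe_act_A_inv,
    if_neg (by linarith), if_pos (by linarith)]

/-- The images of the unit interval under `B` and `A⁻¹B` lie in (0,1/2) and (1/2,1), so at most one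
indicator on the left is nonzero, and only for γ in the unit interval. -/
theorem indicator_act_B_add_le (u : DyadicVertex → ℝ) (hu : ∀ γ, 0 ≤ u γ) (γ : DyadicVertex) :
    unitDyadics.indicator 1 (γ.act ThompsonF.B⁻¹) * u γ +
      unitDyadics.indicator 1 (γ.act (ThompsonF.A⁻¹ * ThompsonF.B)⁻¹) * u γ ≤
      unitDyadics.indicator u γ := by
  set b := γ.act ThompsonF.B⁻¹ with hb
  set c := γ.act (ThompsonF.A⁻¹ * ThompsonF.B)⁻¹ with hc
  have hbγ : b.act ThompsonF.B = γ := (DyadicVertex.actEquiv ThompsonF.B).apply_symm_apply γ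
  have hcγ : c.act (ThompsonF.A⁻¹ * ThompsonF.B) = γ :=
    (DyadicVertex.actEquiv (ThompsonF.A⁻¹ * ThompsonF.B)).apply_symm_apply γ
  have hb1 : b ∈ unitDyadics → 0 < γ.1 ∧ γ.1 < 1 / 2 := fun h => by
    rw [← hbγ, coe_act_B_of_mem h]
    exact ⟨by linarith [h.1], by linarith [h.2]⟩
  have hc1 : c ∈ unitDyadics → 1 / 2 < γ.1 ∧ γ.1 < 1 := fun h => by
    rw [← hcγ, coe_act_A_inv_mul_B_of_mem h]
    exact ⟨by linarith [h.1], by linarith [h.2]⟩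
  by_cases h1 : b ∈ unitDyadics <;> by_cases h2 : c ∈ unitDyadics
  · linarith [(hb1 h1).2, (hc1 h2).1]
  · have : γ ∈ unitDyadics := ⟨(hb1 h1).1, by linarith [(hb1 h1).2]⟩
    simp [h1, h2, this]
  · have : γ ∈ unitDyadics := ⟨by linarith [(hc1 h2).1], (hc1 h2).2⟩
    simp [h1, h2, this]
  · simpa [h1, h2] using Set.indicator_nonneg (fun x _ => hu x) γ

/-- The mass of a square summable function over the unit interval is controlled by its energy. -/
theorem tsum_unitDyadics_sq_le (f : DyadicL2) :
    ∑' γ, unitDyadics.indicator (fun γ => f γ ^ 2) γ ≤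
      6 * (‖f - koopman ThompsonF.B f‖ ^ 2 +
        ‖f - koopman (ThompsonF.A⁻¹ * ThompsonF.B) f‖ ^ 2) := by
  set b := ThompsonF.B
  set c := ThompsonF.A⁻¹ * ThompsonF.B with hc
  set χ : DyadicVertex → ℝ := unitDyadics.indicator 1
  set u : DyadicVertex → ℝ := fun γ => f γ ^ 2
  have hχ : ∀ γ, 0 ≤ χ γ ∧ χ γ ≤ 1 := fun γ =>
    ⟨Set.indicator_nonneg (by simp) γ, Set.indicator_le_self' (by simp) γ⟩
  have hu : Summable u := f.summable_sq
  have hu0 : ∀ γ, 0 ≤ u γ := fun γ => sq_nonneg _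
  have hχu : ∀ g : ThompsonF, Summable fun γ => χ (γ.act g⁻¹) * u γ := fun g =>
    Summable.of_nonneg_of_le (fun γ => mul_nonneg (hχ _).1 (hu0 γ))
      (fun γ => mul_le_of_le_one_left (hu0 γ) (hχ _).2) hu
  have hI : Summable (unitDyadics.indicator u) := hu.indicator _
  have hpull : ∀ g : ThompsonF, ∑' γ, χ γ * u (γ.act g) = ∑' γ, χ (γ.act g⁻¹) * u γ ∧
      Summable fun γ => χ γ * u (γ.act g) := fun g => by
    constructor
    · rw [← (DyadicVertex.actEquiv g).tsum_eq (fun γ => χ (γ.act g⁻¹) * u γ)]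
      refine tsum_congr fun γ => ?_
      rw [DyadicVertex.actEquiv_apply, ← DyadicVertex.act_mul, mul_inv_cancel,
        DyadicVertex.act_one]
    · refine ((DyadicVertex.actEquiv g).summable_iff.2 (hχu g)).congr fun γ => ?_
      rw [Function.comp_apply, DyadicVertex.actEquiv_apply, ← DyadicVertex.act_mul,
        mul_inv_cancel, DyadicVertex.act_one]
  have hle : ∑' γ, χ γ * u (γ.act b) + ∑' γ, χ γ * u (γ.act c) ≤
      ∑' γ, unitDyadics.indicator u γ := by
    rw [(hpull b).1, (hpull c).1,
      ← (hχu b).tsum_add (hχu c)]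
    exact Summable.tsum_le_tsum (indicator_act_B_add_le u hu0)
      ((hχu b).add (hχu c)) hI
  -- Twice the difference of the two sides is a sum of squares. What matters is 3/4 < 1: summing and
  -- using `hle` gives M ≤ (3/4) M + (3/2) E for the mass M, that is, M ≤ 6 E.
  have hpt : ∀ γ, unitDyadics.indicator u γ ≤
      3 / 4 * (χ γ * u (γ.act b) + χ γ * u (γ.act c)) +
        3 / 2 * ((f - koopman b f) γ ^ 2 + (f - koopman c f) γ ^ 2) := fun γ => by
    by_cases h : γ ∈ unitDyadics
    · simp only [Set.indicator_of_mem h, χ, u, Pi.one_apply, lp.coeFn_sub, Pi.sub_apply,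
        koopman_apply]
      nlinarith [sq_nonneg (f (γ.act b) + f (γ.act c) - 2 * (f γ - f (γ.act b) +
        (f γ - f (γ.act c)))), sq_nonneg (f (γ.act b) - f (γ.act c))]
    · simp only [Set.indicator_of_notMem h, χ, zero_mul, add_zero, mul_zero, zero_add]
      positivity
  have hd : ∀ g, Summable fun γ => (f - koopman g f) γ ^ 2 := fun g =>
    DyadicL2.summable_sq _
  have key := Summable.tsum_le_tsum hpt hI
    ((((hpull b).2.add (hpull c).2).mul_left _).add (((hd b).add (hd c)).mul_left _))
  rw [(((hpull b).2.add (hpull c).2).mul_left _).tsum_add (((hd b).add (hd c)).mul_left _),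
    tsum_mul_left, tsum_mul_left, (hpull b).2.tsum_add (hpull c).2, (hd b).tsum_add (hd c),
    ← DyadicL2.norm_sq_eq, ← DyadicL2.norm_sq_eq] at key
  linarith

/-! ### Energy and Green functions of the induced random walk -/

/-- The averaging operator of the random walk on the dyadic rationals. -/
def stepOperator (H : Finset ThompsonF) (w : ThompsonF → ℝ) : DyadicL2 →ₗ[ℝ] DyadicL2 :=
  ∑ h ∈ H, w h • (koopman h).toLinearMap

theorem stepOperator_eq_sum (H : Finset ThompsonF) (w : ThompsonF → ℝ) (f : DyadicL2) :
    stepOperator H w f = ∑ h ∈ H, w h • koopman h f := by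
  simp [stepOperator]

theorem stepOperator_apply (H : Finset ThompsonF) (w : ThompsonF → ℝ) (f : DyadicL2)
    (γ : DyadicVertex) : stepOperator H w f γ = ∑ h ∈ H, w h * f (γ.act h) := by
  rw [stepOperator_eq_sum, lp.coeFn_sum, Finset.sum_apply]
  rfl

/-- The energy of a function on the dyadic rationals. -/
def stepEnergy (H : Finset ThompsonF) (w : ThompsonF → ℝ) (f : DyadicL2) : ℝ :=
  ∑ h ∈ H, w h * ‖f - koopman h f‖ ^ 2

theorem stepEnergy_nonneg {H : Finset ThompsonF} {w : ThompsonF → ℝ} (hw : ∀ h ∈ H, 0 ≤ w h)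
    (f : DyadicL2) : 0 ≤ stepEnergy H w f :=
  Finset.sum_nonneg fun h hh => mul_nonneg (hw h hh) (sq_nonneg _)

/-- Expanding the square uses only that each `koopman h` is an isometry, so the weights need not be
symmetric. -/
theorem stepEnergy_eq_inner {H : Finset ThompsonF} {w : ThompsonF → ℝ} (hw : ∑ h ∈ H, w h = 1)
    (f : DyadicL2) : stepEnergy H w f = 2 * inner ℝ f (f - stepOperator H w f) := by
  have h1 : ∀ h, ‖f - koopman h f‖ ^ 2 = 2 * inner ℝ f f - 2 * inner ℝ f (koopman h f) :=
    fun h => by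
      rw [norm_sub_sq_real, LinearIsometry.norm_map, real_inner_self_eq_norm_sq]
      ring
  rw [inner_sub_right, stepOperator_eq_sum, inner_sum]
  simp only [stepEnergy, h1, inner_smul_right, mul_sub, Finset.sum_sub_distrib]
  rw [← Finset.sum_mul, hw, Finset.mul_sum, one_mul]
  congr 1
  exact Finset.sum_congr rfl fun h _ => by ring

/-- Displacement is subadditive along products, and the energy bounds it on the support. Inverses
are not needed because the support generates as a semigroup. -/
theorem exists_norm_sub_koopman_le {H : Finset ThompsonF} {w : ThompsonF → ℝ}
    (hw : ∀ h ∈ H, 0 < w h) (hH : Subsemigroup.closure (H : Set ThompsonF) = ⊤) (g : ThompsonF) :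
    ∃ C : ℝ, 0 ≤ C ∧ ∀ f : DyadicL2, ‖f - koopman g f‖ ^ 2 ≤ C * stepEnergy H w f := by
  have hg : g ∈ Subsemigroup.closure (H : Set ThompsonF) := hH ▸ Subsemigroup.mem_top g
  induction hg using Subsemigroup.closure_induction with
  | mem h hh =>
    refine ⟨(w h)⁻¹, (inv_pos.2 (hw h hh)).le, fun f => ?_⟩
    rw [← div_eq_inv_mul, le_div_iff₀ (hw h hh), mul_comm]
    exact Finset.single_le_sum (f := fun h => w h * ‖f - koopman h f‖ ^ 2)
      (fun h hh => mul_nonneg (hw h hh).le (sq_nonneg _)) hh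
  | mul a b _ _ ha hb =>
    obtain ⟨C, hC, ha⟩ := ha
    obtain ⟨D, hD, hb⟩ := hb
    refine ⟨2 * C + 2 * D, by positivity, fun f => ?_⟩
    have h1 : f - koopman (a * b) f = (f - koopman a f) + koopman a (f - koopman b f) := by
      rw [koopman_mul, map_sub]
      abel
    have h2 : ‖f - koopman (a * b) f‖ ≤ ‖f - koopman a f‖ + ‖f - koopman b f‖ := by
      rw [h1]
      refine (norm_add_le _ _).trans_eq ?_
      rw [LinearIsometry.norm_map]
    nlinarith [ha f, hb f, norm_nonneg (f - koopman (a * b) f),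
      sq_nonneg (‖f - koopman a f‖ - ‖f - koopman b f‖)]

theorem exists_tsum_unitDyadics_le {H : Finset ThompsonF} {w : ThompsonF → ℝ}
    (hw : ∀ h ∈ H, 0 < w h) (hH : Subsemigroup.closure (H : Set ThompsonF) = ⊤) :
    ∃ C : ℝ, 0 ≤ C ∧ ∀ f : DyadicL2,
      ∑' γ, unitDyadics.indicator (fun γ => f γ ^ 2) γ ≤ C * stepEnergy H w f := by
  obtain ⟨C, hC, h1⟩ := exists_norm_sub_koopman_le hw hH ThompsonF.B
  obtain ⟨D, hD, h2⟩ := exists_norm_sub_koopman_le hw hH (ThompsonF.A⁻¹ * ThompsonF.B)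
  exact ⟨6 * (C + D), by positivity, fun f =>
    (tsum_unitDyadics_sq_le f).trans (by linarith [h1 f, h2 f])⟩

/-! ### Moving dyadic points into the unit interval; pointwise bounds by the energy -/

theorem DyadicVertex.act_A_inv_pow (γ : DyadicVertex) (n : ℕ) :
    (γ.act (ThompsonF.A⁻¹ ^ n)).1 = γ.1 + n := by
  induction n with
  | zero => simp [DyadicVertex.act_one]
  | succ n ih => rw [pow_succ, DyadicVertex.act_mul, coe_act_A_inv, ih]; push_cast; ring

theorem DyadicVertex.act_A_pow (γ : DyadicVertex) (n : ℕ) :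
    (γ.act (ThompsonF.A ^ n)).1 = γ.1 - n := by
  induction n with
  | zero => simp [DyadicVertex.act_one]
  | succ n ih => rw [pow_succ, DyadicVertex.act_mul, coe_act_A, ih]; push_cast; ring

theorem DyadicVertex.exists_act_eq_sub_int (γ : DyadicVertex) (k : ℤ) :
    ∃ g, (γ.act g).1 = γ.1 - k := by
  obtain ⟨n, rfl | rfl⟩ := k.eq_nat_or_neg
  · exact ⟨_, γ.act_A_pow n⟩
  · exact ⟨_, (γ.act_A_inv_pow n).trans (by push_cast; ring)⟩

theorem DyadicVertex.exists_act_mem_unitDyadics (γ : DyadicVertex) :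
    ∃ g, γ.act g ∈ unitDyadics := by
  -- Translation by ⌈γ⌉ - 1 lands in (0,1], integers going to 1; `B` then halves into (0,1/2].
  obtain ⟨g, hg⟩ := γ.exists_act_eq_sub_int (⌈γ.1⌉ - 1)
  have h1 := Int.le_ceil γ.1
  have h2 := Int.ceil_lt_add_one γ.1
  push_cast at hg
  refine ⟨g * ThompsonF.B, ?_, ?_⟩ <;>
  · rw [DyadicVertex.act_mul, DyadicVertex.coe_act_B, hg, if_neg (by linarith),
      if_pos (by linarith)]
    linarith

theorem exists_sq_apply_le {H : Finset ThompsonF} {w : ThompsonF → ℝ}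
    (hw : ∀ h ∈ H, 0 < w h) (hH : Subsemigroup.closure (H : Set ThompsonF) = ⊤)
    (γ : DyadicVertex) : ∃ C : ℝ, 0 ≤ C ∧ ∀ f : DyadicL2, f γ ^ 2 ≤ C * stepEnergy H w f := by
  obtain ⟨g, hg⟩ := γ.exists_act_mem_unitDyadics
  obtain ⟨C, hC, h1⟩ := exists_norm_sub_koopman_le hw hH g
  obtain ⟨D, hD, h2⟩ := exists_tsum_unitDyadics_le hw hH
  refine ⟨2 * (C + D), by positivity, fun f => ?_⟩
  have h3 : f (γ.act g) ^ 2 ≤ D * stepEnergy H w f := by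
    refine le_trans ?_ (h2 f)
    refine le_trans ?_ ((f.summable_sq.indicator unitDyadics).le_tsum (γ.act g) fun x _ =>
      Set.indicator_nonneg (fun _ _ => sq_nonneg _) x)
    rw [Set.indicator_of_mem hg]
  have h4 : (f γ - f (γ.act g)) ^ 2 ≤ C * stepEnergy H w f :=
    ((f - koopman g f).sq_apply_le γ).trans (h1 f)
  nlinarith [sq_nonneg (f γ - 2 * f (γ.act g))]

/-! ### Transition functions and Green functions -/

/-- The unit mass at a dyadic rational. -/
def dyadicSingle (x : DyadicVertex) : DyadicL2 := by
  classical exact lp.single 2 x 1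

theorem dyadicSingle_apply_self (x : DyadicVertex) : dyadicSingle x x = 1 := by
  simp [dyadicSingle]

theorem dyadicSingle_apply_of_ne {x y : DyadicVertex} (h : y ≠ x) : dyadicSingle x y = 0 := by
  simp [dyadicSingle, h]

theorem inner_dyadicSingle (x : DyadicVertex) (f : DyadicL2) :
    inner ℝ f (dyadicSingle x) = f x := by
  classical
  rw [dyadicSingle, lp.inner_single_right]
  simp

/-- The `n`-step transition function to the point `x`. -/
def stepTransition (H : Finset ThompsonF) (w : ThompsonF → ℝ) (x : DyadicVertex) (n : ℕ) :
    DyadicL2 :=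
  (stepOperator H w ^ n) (dyadicSingle x)

theorem stepTransition_zero (H : Finset ThompsonF) (w : ThompsonF → ℝ) (x : DyadicVertex) :
    stepTransition H w x 0 = dyadicSingle x := by
  simp [stepTransition]

theorem stepTransition_succ (H : Finset ThompsonF) (w : ThompsonF → ℝ) (x : DyadicVertex)
    (n : ℕ) :
    stepTransition H w x (n + 1) = stepOperator H w (stepTransition H w x n) := by
  rw [stepTransition, pow_succ', Module.End.mul_apply, stepTransition]

theorem stepTransition_nonneg {H : Finset ThompsonF} {w : ThompsonF → ℝ}
    (hw : ∀ h ∈ H, 0 < w h) (x : DyadicVertex) (n : ℕ) (γ : DyadicVertex) :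
    0 ≤ stepTransition H w x n γ := by
  induction n generalizing γ with
  | zero =>
    rw [stepTransition_zero]
    rcases eq_or_ne γ x with rfl | h
    · simp [dyadicSingle_apply_self]
    · simp [dyadicSingle_apply_of_ne h]
  | succ n ih =>
    rw [stepTransition_succ, stepOperator_apply]
    exact Finset.sum_nonneg fun h hh => mul_nonneg (hw h hh).le (ih _)

theorem inner_nonneg_of_nonneg {f g : DyadicL2} (hf : ∀ γ, 0 ≤ f γ) (hg : ∀ γ, 0 ≤ g γ) :
    0 ≤ inner ℝ f g := by
  rw [lp.inner_eq_tsum]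
  exact tsum_nonneg fun γ => by simpa using mul_nonneg (hg γ) (hf γ)

/-- Applying I - P to the truncated Green function telescopes to δ_x - P^N δ_x, and the second term
contributes with a favourable sign by positivity. -/
theorem stepEnergy_sum_stepTransition_le {H : Finset ThompsonF} {w : ThompsonF → ℝ}
    (hw : ∀ h ∈ H, 0 < w h) (hw1 : ∑ h ∈ H, w h = 1) (x : DyadicVertex) (N : ℕ) :
    stepEnergy H w (∑ n ∈ Finset.range N, stepTransition H w x n) ≤
      2 * (∑ n ∈ Finset.range N, stepTransition H w x n) x := by
  set f := ∑ n ∈ Finset.range N, stepTransition H w x n with hf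
  have h1 : f - stepOperator H w f = dyadicSingle x - stepTransition H w x N := by
    rw [hf, map_sum, ← Finset.sum_sub_distrib, ← stepTransition_zero H w x]
    simp_rw [← stepTransition_succ]
    exact Finset.sum_range_sub' _ _
  rw [stepEnergy_eq_inner hw1, h1, inner_sub_right, inner_dyadicSingle]
  have : 0 ≤ inner ℝ f (stepTransition H w x N) :=
    inner_nonneg_of_nonneg (fun γ => by
      rw [hf, lp.coeFn_sum, Finset.sum_apply]
      exact Finset.sum_nonneg fun n _ => stepTransition_nonneg hw x n γ)
      (stepTransition_nonneg hw x N)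
  linarith

theorem exists_stepEnergy_sum_le {H : Finset ThompsonF} {w : ThompsonF → ℝ}
    (hw : ∀ h ∈ H, 0 < w h) (hw1 : ∑ h ∈ H, w h = 1)
    (hH : Subsemigroup.closure (H : Set ThompsonF) = ⊤) (x : DyadicVertex) :
    ∃ E : ℝ, ∀ N, stepEnergy H w (∑ n ∈ Finset.range N, stepTransition H w x n) ≤ E := by
  obtain ⟨C, hC, h1⟩ := exists_sq_apply_le hw hH x
  -- From E ≤ 2 f(x) and f(x)² ≤ C E follows E² ≤ 4 C E.
  refine ⟨4 * C, fun N => ?_⟩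
  have h2 := stepEnergy_sum_stepTransition_le hw hw1 x N
  have h3 := h1 (∑ n ∈ Finset.range N, stepTransition H w x n)
  set f := ∑ n ∈ Finset.range N, stepTransition H w x n
  have h0 := stepEnergy_nonneg (fun h hh => (hw h hh).le) f
  by_contra! hlt
  nlinarith

/-- Transience of the random walk on the dyadic rationals. -/
theorem summable_stepTransition {H : Finset ThompsonF} {w : ThompsonF → ℝ}
    (hw : ∀ h ∈ H, 0 < w h) (hw1 : ∑ h ∈ H, w h = 1)
    (hH : Subsemigroup.closure (H : Set ThompsonF) = ⊤) (x γ : DyadicVertex) :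
    Summable fun n => stepTransition H w x n γ := by
  obtain ⟨E, hE⟩ := exists_stepEnergy_sum_le hw hw1 hH x
  obtain ⟨C, hC, h1⟩ := exists_sq_apply_le hw hH γ
  refine summable_of_sum_range_le (c := C * E + 1) (fun n => stepTransition_nonneg hw x n γ)
    fun N => ?_
  have h2 := (h1 (∑ n ∈ Finset.range N, stepTransition H w x n)).trans
    (mul_le_mul_of_nonneg_left (hE N) hC)
  rw [lp.coeFn_sum, Finset.sum_apply] at h2
  nlinarith [sq_nonneg (∑ n ∈ Finset.range N, stepTransition H w x n γ - 1)]

/-- The Green function tends to zero at infinity in the unit interval. -/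
theorem finite_le_tsum_stepTransition {H : Finset ThompsonF} {w : ThompsonF → ℝ}
    (hw : ∀ h ∈ H, 0 < w h) (hw1 : ∑ h ∈ H, w h = 1)
    (hH : Subsemigroup.closure (H : Set ThompsonF) = ⊤) (x : DyadicVertex) {ε : ℝ} (hε : 0 < ε) :
    {γ ∈ unitDyadics | ε ≤ ∑' n, stepTransition H w x n γ}.Finite := by
  obtain ⟨E, hE⟩ := exists_stepEnergy_sum_le hw hw1 hH x
  obtain ⟨C, hC, h1⟩ := exists_tsum_unitDyadics_le hw hH
  have hsum : Summable fun γ =>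
      unitDyadics.indicator (fun γ => (∑' n, stepTransition H w x n γ) ^ 2) γ := by
    refine summable_of_sum_le (c := C * E)
      (fun γ => Set.indicator_nonneg (fun _ _ => sq_nonneg _) γ) fun T => ?_
    -- Fatou argument: over a finite set T the truncated Green functions converge pointwise, and the
    -- bound `C * E` is uniform in N and T.
    refine le_of_tendsto (f := fun N => ∑ γ ∈ T, unitDyadics.indicator
      (fun γ => (∑ n ∈ Finset.range N, stepTransition H w x n γ) ^ 2) γ) (x := atTop)
      (tendsto_finsetSum _ fun γ _ => ?_) (Eventually.of_forall fun N => ?_)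
    · by_cases h : γ ∈ unitDyadics
      · simp only [Set.indicator_of_mem h]
        exact ((summable_stepTransition hw hw1 hH x γ).hasSum.tendsto_sum_nat).pow 2
      · simp only [Set.indicator_of_notMem h]
        exact tendsto_const_nhds
    · refine le_trans ?_ ((h1 (∑ n ∈ Finset.range N, stepTransition H w x n)).trans
        (mul_le_mul_of_nonneg_left (hE N) hC))
      refine le_trans (le_of_eq ?_) (((DyadicL2.summable_sq
        (∑ n ∈ Finset.range N, stepTransition H w x n)).indicator unitDyadics).sum_le_tsum T
          fun x _ => Set.indicator_nonneg (fun _ _ => sq_nonneg _) x)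
      simp only [lp.coeFn_sum, Finset.sum_apply]
  have h2 := hsum.tendsto_cofinite_zero.eventually_lt_const (show (0 : ℝ) < ε ^ 2 by positivity)
  rw [eventually_cofinite] at h2
  refine h2.subset fun γ hγ => ?_
  rw [Set.mem_ofPred_eq, Set.indicator_of_mem hγ.1, not_lt]
  exact pow_le_pow_left₀ hε.le hγ.2 2

/-! ### The first step of a random walk -/

/-- The sequence with a prescribed first entry and tail. -/
def consSeq {α : Type} (a : α) (x : ℕ → α) : ℕ → α
  | 0 => a
  | n + 1 => x n

theorem measurable_consSeq {α : Type} [MeasurableSpace α] :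
    Measurable fun p : α × (ℕ → α) => consSeq p.1 p.2 := by
  refine measurable_pi_iff.2 fun n => ?_
  cases n with
  | zero => exact measurable_fst
  | succ n => exact (measurable_pi_apply n).comp measurable_snd

/-- This splits off the first increment of the walk, which yields the Markov property at time one.
-/
theorem measurePreserving_consSeq {α : Type} [MeasurableSpace α] (m : Measure α)
    [IsProbabilityMeasure m] :
    MeasurePreserving (fun p : α × (ℕ → α) => consSeq p.1 p.2)
      (m.prod (Measure.infinitePi fun _ : ℕ => m)) (Measure.infinitePi fun _ : ℕ => m) := by
  classical
  refine ⟨measurable_consSeq, Measure.eq_infinitePi _ fun s t ht => ?_⟩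
  obtain ⟨n, hn⟩ := s.exists_nat_subset_range
  -- Padding with the whole space turns a cylinder over `s` into one over an initial segment, where
  -- removing the first coordinate is an index shift.
  set t' : ℕ → Set α := fun i => if i ∈ s then t i else Set.univ with ht'
  have hmt' : ∀ i, MeasurableSet (t' i) := fun i => by
    rw [ht']
    dsimp only
    split_ifs
    exacts [ht i, MeasurableSet.univ]
  have hsub : s ⊆ Finset.range (n + 1) :=
    hn.trans (Finset.range_subset_range.2 n.le_succ)
  have h1 : ∏ i ∈ s, m (t i) = ∏ i ∈ Finset.range (n + 1), m (t' i) := by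
    rw [← Finset.prod_subset hsub (f := fun i => m (t' i))]
    · exact Finset.prod_congr rfl fun i hi => by simp [ht', hi]
    · intro i _ hi
      simp [ht', hi]
  have h2 : (fun p : α × (ℕ → α) => consSeq p.1 p.2) ⁻¹' Set.pi s t =
      t' 0 ×ˢ Set.pi (Finset.range n) (fun i => t' (i + 1)) := by
    ext ⟨a, x⟩
    simp only [Set.mem_preimage, Set.mem_pi, Finset.mem_coe, Set.mem_prod, Finset.mem_range]
    constructor
    · intro h
      refine ⟨?_, fun i _ => ?_⟩
      · by_cases h0 : 0 ∈ s
        · simpa [ht', h0, consSeq] using h 0 h0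
        · simp [ht', h0]
      · by_cases hi : i + 1 ∈ s
        · simpa [ht', hi, consSeq] using h (i + 1) hi
        · simp [ht', hi]
    · rintro ⟨h0, h⟩ i hi
      cases i with
      | zero => simpa [ht', hi, consSeq] using h0
      | succ i =>
        have := h i (by have := Finset.mem_range.1 (hsub hi); omega)
        simpa [ht', hi, consSeq] using this
  rw [Measure.map_apply measurable_consSeq (.pi s.countable_toSet fun i _ => ht i), h2,
    Measure.prod_prod, Measure.infinitePi_pi _ fun i _ => hmt' _, h1, Finset.prod_range_succ',
    mul_comm]

theorem walkPath_mul {G : Type} [Group G] (a b : G) (h : ℕ → G) (n : ℕ) :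
    walkPath (a * b) h n = a * walkPath b h n := by
  induction n with
  | zero => rfl
  | succ n ih => simp only [walkPath, ih, mul_assoc]

theorem walkPath_consSeq_succ {G : Type} [Group G] (a b : G) (h : ℕ → G) (n : ℕ) :
    walkPath a (consSeq b h) (n + 1) = walkPath (a * b) h n := by
  induction n with
  | zero => rfl
  | succ n ih =>
    rw [walkPath, ih]
    rfl

instance ThompsonF.instCountable : Countable ThompsonF := by
  have h : thompsonSubgroup = (FreeGroup.lift fun s : ({MulOpposite.op thompsonA,
      MulOpposite.op thompsonB} : Set (ℝ ≃ₜ ℝ)ᵐᵒᵖ) => (s : (ℝ ≃ₜ ℝ)ᵐᵒᵖ)).range := by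
    rw [FreeGroup.range_lift_eq_closure, Subtype.range_coe]
    rfl
  have : Countable (FreeGroup ({MulOpposite.op thompsonA,
      MulOpposite.op thompsonB} : Set (ℝ ≃ₜ ℝ)ᵐᵒᵖ)) :=
    (Quot.mk_surjective (r := FreeGroup.Red.Step)).countable
  rw [ThompsonF, h]
  exact (MonoidHom.rangeRestrict_surjective _).countable

instance ThompsonF.instDiscreteMeasurableSpace : DiscreteMeasurableSpace ThompsonF :=
  ⟨fun _ => trivial⟩

theorem measurableSet_eval {α : Type} [MeasurableSpace α] [DiscreteMeasurableSpace α] (n : ℕ)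
    (p : α → Prop) : MeasurableSet {x : ℕ → α | p (x n)} := by
  have h := measurable_pi_apply (X := fun _ : ℕ => α) n
  exact h (MeasurableSet.of_discrete (s := {a | p a}))

section

variable {G : Type} [Group G] [MeasurableSpace G] [Countable G] [DiscreteMeasurableSpace G]

theorem measurable_walkPath (g : G) : Measurable (walkPath g) := by
  refine measurable_pi_iff.2 fun n => ?_
  induction n with
  | zero => exact measurable_const
  | succ n ih =>
    exact (Measurable.of_discrete (f := fun p : G × G => p.1 * p.2)).comp
      (ih.prodMk (measurable_pi_apply n))

instance (μ : PMF G) (g : G) : IsProbabilityMeasure (pathMeasureFrom μ g) :=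
  Measure.isProbabilityMeasure_map (measurable_walkPath g).aemeasurable

instance (μ : PMF G) : IsProbabilityMeasure (pathMeasure μ) :=
  inferInstanceAs (IsProbabilityMeasure (pathMeasureFrom μ 1))

/-- The Markov property of the random walk at time one. -/
theorem pathMeasure_preimage_timeShift (μ : PMF G) {s : Set (ℕ → G)} (hs : MeasurableSet s) :
    pathMeasure μ (timeShift ⁻¹' s) =
      ∑' h, μ h * pathMeasure μ ((fun x n => h * x n) ⁻¹' s) := by
  have hT : Measurable (timeShift : (ℕ → G) → ℕ → G) :=
    measurable_pi_iff.2 fun n => measurable_pi_apply (n + 1)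
  have hL : ∀ h : G, Measurable fun (x : ℕ → G) n => h * x n := fun h =>
    measurable_pi_iff.2 fun n => Measurable.of_discrete.comp (measurable_pi_apply n)
  have hw := measurable_walkPath (1 : G)
  rw [pathMeasure, pathMeasureFrom, Measure.map_apply hw (hT hs),
    ← (measurePreserving_consSeq μ.toMeasure).measure_preimage
      (hw (hT hs)).nullMeasurableSet,
    Measure.prod_apply (measurable_consSeq (hw (hT hs))), lintegral_countable']
  refine tsum_congr fun h => ?_
  rw [μ.toMeasure_apply_singleton h (measurableSet_singleton h), mul_comm,
    Measure.map_apply hw (hL h hs)]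
  congr 2
  ext x
  have : timeShift (walkPath 1 (consSeq h x)) = fun n => h * walkPath 1 x n := by
    funext n
    rw [timeShift, walkPath_consSeq_succ, ← walkPath_mul, one_mul, mul_one]
  simp only [Set.mem_preimage, this]

theorem ae_pathMeasure_zero (μ : PMF G) : ∀ᵐ x ∂(pathMeasure μ), x 0 = 1 := by
  have hm : MeasurableSet {x : ℕ → G | x 0 = 1} :=
    measurableSet_eval 0 fun g => g = 1
  rw [pathMeasure, pathMeasureFrom, ae_map_iff (measurable_walkPath _).aemeasurable hm]
  exact Eventually.of_forall fun h => rfl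

theorem ae_pathMeasure_step (μ : PMF G) :
    ∀ᵐ x ∂(pathMeasure μ), ∀ n, ∃ h ∈ μ.support, x (n + 1) = x n * h := by
  have hm : MeasurableSet {x : ℕ → G | ∀ n, ∃ h ∈ μ.support, x (n + 1) = x n * h} := by
    rw [Set.ofPred_forall]
    refine .iInter fun n => ?_
    have h := (measurable_pi_apply (X := fun _ => G) (n + 1)).prodMk (measurable_pi_apply n)
    exact h (MeasurableSet.of_discrete (s := {p : G × G | ∃ h ∈ μ.support, p.1 = p.2 * h}))
  rw [pathMeasure, pathMeasureFrom, ae_map_iff (measurable_walkPath _).aemeasurable hm]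
  refine ae_all_iff.2 fun n => ?_
  have h1 : ∀ᵐ h ∂μ.toMeasure, h ∈ μ.support := by
    rw [ae_iff, μ.toMeasure_apply_eq_zero_iff .of_discrete]
    exact Set.disjoint_left.2 fun a ha hb => hb ha
  have h2 := (measurePreserving_eval_infinitePi (fun _ : ℕ => μ.toMeasure) n).quasiMeasurePreserving.ae h1
  filter_upwards [h2] with h hh
  exact ⟨h n, hh, rfl⟩

/-- If a property holds almost surely, then it holds almost surely for the walk continued after any
admissible first step. -/
theorem ae_pathMeasure_of_ae_timeShift (μ : PMF G) {p : (ℕ → G) → Prop}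
    (hp : ∀ᵐ x ∂(pathMeasure μ), p (timeShift x)) (hm : MeasurableSet {x | p x})
    {h : G} (hh : h ∈ μ.support) : ∀ᵐ x ∂(pathMeasure μ), p fun n => h * x n := by
  have h1 := pathMeasure_preimage_timeShift μ hm.compl
  rw [show pathMeasure μ (timeShift ⁻¹' {x | p x}ᶜ) = 0 from hp] at h1
  have h2 := ENNReal.tsum_eq_zero.1 h1.symm h
  exact (mul_eq_zero.1 h2).resolve_left ((μ.mem_support_iff h).1 hh)

end

/-! ### Transience -/

instance DyadicVertex.instCountable : Countable DyadicVertex := by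
  refine Set.Countable.mono (s₂ := Set.range fun p : ℤ × ℕ => (p.1 : ℝ) / 2 ^ p.2) ?_
    (Set.countable_range _)
  rintro _ ⟨k, n, rfl⟩
  exact ⟨(k, n), rfl⟩

theorem measurableSet_act_mem (γ : DyadicVertex) (n : ℕ) (S : Set DyadicVertex) :
    MeasurableSet {x : ℕ → ThompsonF | γ.act (x n) ∈ S} :=
  measurableSet_eval n fun g => γ.act g ∈ S

theorem sum_toReal_eq_one (μ : PMF ThompsonF) (hfin : μ.support.Finite) :
    ∑ h ∈ hfin.toFinset, (μ h).toReal = 1 := by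
  rw [← ENNReal.toReal_sum fun h _ => μ.apply_ne_top h, ← tsum_eq_sum (L := .unconditional _)
    (f := fun h => μ h), μ.tsum_coe, ENNReal.toReal_one]
  intro h hh
  rw [Set.Finite.mem_toFinset, PMF.mem_support_iff, not_not] at hh
  exact hh

theorem toReal_pos_of_mem (μ : PMF ThompsonF) (hfin : μ.support.Finite) :
    ∀ h ∈ hfin.toFinset, 0 < (μ h).toReal := fun h hh =>
  ENNReal.toReal_pos ((μ.mem_support_iff h).1 (hfin.mem_toFinset.1 hh)) (μ.apply_ne_top h)

/-- Conditioning on the first step gives the hitting probabilities the recursion that defines the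
powers of the averaging operator. -/
theorem pathMeasure_act_eq (μ : PMF ThompsonF) (hfin : μ.support.Finite)
    (x : DyadicVertex) (n : ℕ) (γ : DyadicVertex) :
    pathMeasure μ {g | γ.act (g n) = x} =
      ENNReal.ofReal (stepTransition hfin.toFinset (fun h => (μ h).toReal) x n γ) := by
  induction n generalizing γ with
  | zero =>
    rw [stepTransition_zero]
    have h0 := ae_pathMeasure_zero μ
    rcases eq_or_ne γ x with rfl | h
    · rw [dyadicSingle_apply_self, ENNReal.ofReal_one]
      refine (mem_ae_iff_prob_eq_one (measurableSet_act_mem γ 0 {γ})).1 ?_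
      filter_upwards [h0] with g hg
      change γ.act (g 0) = γ
      rw [hg, DyadicVertex.act_one]
    · rw [dyadicSingle_apply_of_ne h, ENNReal.ofReal_zero]
      refine measure_mono_null (t := {g | ¬ g 0 = 1}) (fun g hg h1 => h ?_) h0
      rw [← hg, h1, DyadicVertex.act_one]
  | succ n ih =>
    have h1 := pathMeasure_preimage_timeShift μ (measurableSet_act_mem γ n {x})
    refine h1.trans ?_
    rw [stepTransition_succ, stepOperator_apply, ENNReal.ofReal_sum_of_nonneg fun h hh =>
      mul_nonneg ENNReal.toReal_nonneg (stepTransition_nonneg (toReal_pos_of_mem μ hfin) x n _),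
      tsum_eq_sum (s := hfin.toFinset)]
    · refine Finset.sum_congr rfl fun h _ => ?_
      rw [ENNReal.ofReal_mul ENNReal.toReal_nonneg, ENNReal.ofReal_toReal (μ.apply_ne_top h), ← ih]
      rfl
    · intro h hh
      rw [Set.Finite.mem_toFinset, PMF.mem_support_iff, not_not] at hh
      rw [hh, zero_mul]

theorem closure_toFinset_eq_top (μ : PMF ThompsonF) (hfin : μ.support.Finite)
    (hnd : StrictlyNondegenerate μ) :
    Subsemigroup.closure (hfin.toFinset : Set ThompsonF) = ⊤ := by
  rw [hfin.coe_toFinset]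
  exact hnd

theorem tsum_pathMeasure_act_eq (μ : PMF ThompsonF) (hfin : μ.support.Finite)
    (hnd : StrictlyNondegenerate μ) (x γ : DyadicVertex) :
    ∑' n, pathMeasure μ {g | γ.act (g n) = x} = ENNReal.ofReal
      (∑' n, stepTransition hfin.toFinset (fun h => (μ h).toReal) x n γ) := by
  rw [ENNReal.ofReal_tsum_of_nonneg (fun n => stepTransition_nonneg (toReal_pos_of_mem μ hfin) x n γ)
    (summable_stepTransition (toReal_pos_of_mem μ hfin) (sum_toReal_eq_one μ hfin)
      (closure_toFinset_eq_top μ hfin hnd) x γ)]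
  exact tsum_congr fun n => pathMeasure_act_eq μ hfin x n γ

/-- Almost surely the induced random walks on the dyadic rationals leave all finite sets. -/
theorem ae_eventually_act_notMem (μ : PMF ThompsonF) (hfin : μ.support.Finite)
    (hnd : StrictlyNondegenerate μ) :
    ∀ᵐ g ∂(pathMeasure μ), ∀ γ : DyadicVertex, ∀ S : Set DyadicVertex, S.Finite →
      ∀ᶠ n in atTop, γ.act (g n) ∉ S := by
  -- Borel–Cantelli for each of the countably many pairs: the expected number of visits is the
  -- finite Green function.
  have h1 : ∀ᵐ g ∂(pathMeasure μ), ∀ γ x : DyadicVertex, ∀ᶠ n in atTop, γ.act (g n) ≠ x := by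
    refine ae_all_iff.2 fun γ => ae_all_iff.2 fun x => ae_eventually_notMem ?_
    exact (tsum_pathMeasure_act_eq μ hfin hnd x γ).trans_ne ENNReal.ofReal_ne_top
  filter_upwards [h1] with g hg γ S hS
  have := (eventually_all_finite hS).2 fun x _ => hg γ x
  filter_upwards [this] with n hn hmem
  exact hn _ hmem rfl

/-- From most points of the unit interval a given finite set is avoided with positive
probability. -/
theorem finite_pathMeasure_avoid_eq_zero (μ : PMF ThompsonF) (hfin : μ.support.Finite)
    (hnd : StrictlyNondegenerate μ)
    {S : Set DyadicVertex} (hS : S.Finite) :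
    {γ ∈ unitDyadics | pathMeasure μ {g | ∀ n, γ.act (g n) ∉ S} = 0}.Finite := by
  set Q := fun x n γ => stepTransition hfin.toFinset (fun h => (μ h).toReal) x n γ
  -- Chosen so that the union bound over the points of S gives |S| / (|S| + 1) < 1.
  set ε : ℝ := 1 / (hS.toFinset.card + 1) with hε
  have hε0 : 0 < ε := by positivity
  have hQ := fun x => finite_le_tsum_stepTransition (toReal_pos_of_mem μ hfin)
    (sum_toReal_eq_one μ hfin) (closure_toFinset_eq_top μ hfin hnd) x hε0
  refine (hS.biUnion fun x _ => hQ x).subset fun γ hγ => ?_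
  by_contra hcon
  simp only [Set.mem_iUnion, Set.mem_sep_iff, not_exists, not_and, not_le] at hcon
  have h1 : pathMeasure μ {g | ∃ n, γ.act (g n) ∈ S} < 1 := by
    calc pathMeasure μ {g | ∃ n, γ.act (g n) ∈ S}
        ≤ pathMeasure μ (⋃ x ∈ hS.toFinset, ⋃ n, {g | γ.act (g n) = x}) := by
          refine measure_mono ?_
          rintro g ⟨n, hn⟩
          simp only [Set.mem_iUnion]
          exact ⟨_, hS.mem_toFinset.2 hn, n, rfl⟩
      _ ≤ ∑ x ∈ hS.toFinset, ∑' n, pathMeasure μ {g | γ.act (g n) = x} :=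
          (measure_biUnion_finset_le _ _).trans
            (Finset.sum_le_sum fun x _ => measure_iUnion_le _)
      _ ≤ ∑ x ∈ hS.toFinset, ENNReal.ofReal ε := by
          refine Finset.sum_le_sum fun x hx => ?_
          rw [tsum_pathMeasure_act_eq μ hfin hnd]
          exact ENNReal.ofReal_le_ofReal (hcon x (hS.mem_toFinset.1 hx) hγ.1).le
      _ < 1 := by
          rw [Finset.sum_const, nsmul_eq_mul, ← ENNReal.ofReal_natCast,
            ← ENNReal.ofReal_mul (by positivity), ENNReal.ofReal_lt_one, hε, mul_one_div,
            div_lt_one (by positivity)]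
          linarith
  have hm : MeasurableSet {g : ℕ → ThompsonF | ∃ n, γ.act (g n) ∈ S} := by
    rw [Set.ofPred_exists]
    exact .iUnion fun n => measurableSet_act_mem γ n S
  have h2 := prob_compl_eq_zero_iff hm (μ := pathMeasure μ)
  refine h1.ne (h2.1 ?_)
  rw [← hγ.2]
  congr 1
  ext g
  simp

/-! ### Convergence to the ends of a countable graph -/

section

variable {V : Type} {G : SimpleGraph V}

theorem componentCompl_eq_of_mem {K : Set V} {C D : G.ComponentCompl K} {v : V} (hC : v ∈ C)
    (hD : v ∈ D) : C = D := by
  obtain ⟨_, rfl⟩ := hC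
  obtain ⟨_, rfl⟩ := hD
  rfl

theorem EndSpace.ext_component {ω ω' : EndSpace G}
    (h : ∀ K : Finset V, ω.component K = ω'.component K) : ω = ω' :=
  Subtype.ext (funext fun K => h K.unop)

theorem ConvergesToEnd.unique {x : ℕ → V} {ω ω' : EndSpace G} (h : ConvergesToEnd G x ω)
    (h' : ConvergesToEnd G x ω') : ω = ω' := by
  refine EndSpace.ext_component fun K => ?_
  obtain ⟨n, h1, h2⟩ := ((h K).and (h' K)).exists
  exact componentCompl_eq_of_mem h1 h2

/-- Coherence of the chosen components is automatic: for K ⊆ L, one term of the sequence lies in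
both choices. -/
theorem exists_convergesToEnd_iff {x : ℕ → V} :
    (∃ ω, ConvergesToEnd G x ω) ↔
      ∀ K : Finset V, ∃ C : G.ComponentCompl (K : Set V), ∀ᶠ n in atTop, x n ∈ C := by
  refine ⟨fun ⟨ω, h⟩ K => ⟨_, h K⟩, fun h => ?_⟩
  choose c hc using h
  refine ⟨⟨fun K => c K.unop, fun {L K} f => ?_⟩, hc⟩
  obtain ⟨n, h1, h2⟩ := ((hc L.unop).and (hc K.unop)).exists
  have hKL : (K.unop : Set V) ⊆ L.unop := CategoryTheory.le_of_op_hom f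
  exact componentCompl_eq_of_mem ((c L.unop).subset_hom hKL h1) h2

theorem convergesToEnd_shift_iff {x : ℕ → V} {ω : EndSpace G} :
    ConvergesToEnd G (fun n => x (n + 1)) ω ↔ ConvergesToEnd G x ω :=
  forall_congr' fun K => by
    conv_rhs => rw [← map_add_atTop_eq_nat 1, eventually_map]

open Classical in
/-- The end to which a sequence of vertices converges, and `e` if there is no such end. -/
def endLimit (e : EndSpace G) (x : ℕ → V) : EndSpace G :=
  if h : ∃ ω, ConvergesToEnd G x ω then h.choose else e

theorem convergesToEnd_endLimit (e : EndSpace G) {x : ℕ → V}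
    (h : ∃ ω, ConvergesToEnd G x ω) : ConvergesToEnd G x (endLimit e x) := by
  rw [endLimit, dif_pos h]
  exact h.choose_spec

theorem endLimit_of_not_exists (e : EndSpace G) {x : ℕ → V}
    (h : ¬ ∃ ω, ConvergesToEnd G x ω) : endLimit e x = e :=
  dif_neg h

theorem endLimit_shift (e : EndSpace G) (x : ℕ → V) :
    endLimit e (fun n => x (n + 1)) = endLimit e x := by
  have h : ConvergesToEnd G (fun n => x (n + 1)) = ConvergesToEnd G x :=
    funext fun _ => propext convergesToEnd_shift_iff
  unfold endLimit
  rw [h]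

/-! ### Measurable structure of the space of ends -/

variable [Countable V]

instance EndSpace.instBorelSpace : BorelSpace (EndSpace G) := ⟨rfl⟩

theorem countable_componentCompl (K : Set V) : Countable (G.ComponentCompl K) :=
  inferInstanceAs (Countable (Quot (G.induce Kᶜ).Reachable))

/-- The coherence conditions cut out a closed subset of a countable product of countable discrete
spaces. -/
instance EndSpace.instPolishSpace : PolishSpace (EndSpace G) := by
  let : ∀ K : Finset V, TopologicalSpace (G.ComponentCompl (K : Set V)) := fun _ => ⊥
  have : ∀ K : Finset V, DiscreteTopology (G.ComponentCompl (K : Set V)) := fun _ => ⟨rfl⟩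
  have : ∀ K : Finset V, Countable (G.ComponentCompl (K : Set V)) := fun K =>
    countable_componentCompl _
  let c : EndSpace G → ∀ K : Finset V, G.ComponentCompl (K : Set V) := fun ω K => ω.component K
  have hr : Set.range c = ⋂ (K : Finset V) (L : Finset V) (h : (K : Set V) ⊆ L),
      {s | (s L).hom h = s K} := by
    ext s
    simp only [Set.mem_iInter]
    constructor
    · rintro ⟨ω, rfl⟩ K L h
      exact ω.2 (CategoryTheory.homOfLE h : K ⟶ L).op
    · intro h
      exact ⟨⟨fun K => s K.unop, fun {L K} f => h K.unop L.unop (CategoryTheory.le_of_op_hom f)⟩,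
        rfl⟩
  have hc : IsClosedEmbedding c := by
    refine ⟨⟨⟨rfl⟩, fun ω ω' h => EndSpace.ext_component fun K => congrFun h K⟩, ?_⟩
    rw [hr]
    refine isClosed_iInter fun K => isClosed_iInter fun L => isClosed_iInter fun h => ?_
    exact isClosed_eq (continuous_of_discreteTopology.comp (continuous_apply L))
      (continuous_apply K)
  exact hc.polishSpace

/-- In a countable product of countable discrete spaces the Borel and product σ-algebras agree, so
measurability is tested on single components. -/
theorem measurable_endSpace {X : Type} [MeasurableSpace X] {f : X → EndSpace G}
    (h : ∀ (K : Finset V) (C : G.ComponentCompl (K : Set V)),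
      MeasurableSet {x | (f x).component K = C}) : Measurable f := by
  let : ∀ K : Finset V, TopologicalSpace (G.ComponentCompl (K : Set V)) := fun _ => ⊥
  have : ∀ K : Finset V, DiscreteTopology (G.ComponentCompl (K : Set V)) := fun _ => ⟨rfl⟩
  have : ∀ K : Finset V, Countable (G.ComponentCompl (K : Set V)) := fun K =>
    countable_componentCompl _
  let : ∀ K : Finset V, MeasurableSpace (G.ComponentCompl (K : Set V)) := fun _ => borel _
  have : ∀ K : Finset V, BorelSpace (G.ComponentCompl (K : Set V)) := fun _ => ⟨rfl⟩
  have h1 : EndSpace.instMeasurableSpace G = MeasurableSpace.comap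
      (fun (ω : EndSpace G) (K : Finset V) => ω.component K) MeasurableSpace.pi := by
    rw [BorelSpace.measurable_eq (α := ∀ K : Finset V, G.ComponentCompl (K : Set V)),
      ← borel_comap]
    rfl
  rw [h1, measurable_comap_iff, measurable_pi_iff]
  exact fun K => measurable_to_countable' fun C => h K C

theorem measurableSet_exists_convergesToEnd {X : Type} [MeasurableSpace X] {x : X → ℕ → V}
    (hx : ∀ n (S : Set V), MeasurableSet {a | x a n ∈ S}) :
    MeasurableSet {a | ∃ ω, ConvergesToEnd G (x a) ω} := by
  have : ∀ K : Finset V, Countable (G.ComponentCompl (K : Set V)) := fun K =>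
    countable_componentCompl _
  simp only [exists_convergesToEnd_iff, eventually_atTop]
  refine measurableSet_setOfPred.2 ?_
  refine Measurable.forall fun K => Measurable.exists fun C => Measurable.exists fun N =>
    Measurable.forall fun n => Measurable.imp measurable_const ?_
  exact measurableSet_setOfPred.1 (hx n C)

theorem measurable_endLimit {X : Type} [MeasurableSpace X] (e : EndSpace G) {x : X → ℕ → V}
    (hx : ∀ n (S : Set V), MeasurableSet {a | x a n ∈ S}) :
    Measurable fun a => endLimit e (x a) := by
  refine measurable_endSpace fun K C => ?_
  have hE := measurableSet_exists_convergesToEnd (G := G) hx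
  have hC : MeasurableSet {a | ∀ᶠ n in atTop, x a n ∈ C} := by
    simp only [eventually_atTop]
    refine measurableSet_setOfPred.2 (Measurable.exists fun N =>
      Measurable.forall fun n => Measurable.imp measurable_const ?_)
    exact measurableSet_setOfPred.1 (hx n C)
  have h1 : {a | (endLimit e (x a)).component K = C} =
      ({a | ∃ ω, ConvergesToEnd G (x a) ω} ∩ {a | ∀ᶠ n in atTop, x a n ∈ C}) ∪
        ({a | ∃ ω, ConvergesToEnd G (x a) ω}ᶜ ∩ {_a | e.component K = C}) := by
    ext a
    by_cases h : ∃ ω, ConvergesToEnd G (x a) ω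
    · have h2 := convergesToEnd_endLimit e h K
      have h3 : (endLimit e (x a)).component K = C ↔ ∀ᶠ n in atTop, x a n ∈ C := by
        constructor
        · rintro rfl
          exact h2
        · intro h4
          obtain ⟨n, h5, h6⟩ := (h2.and h4).exists
          exact componentCompl_eq_of_mem h5 h6
      simp [h, h3]
    · simp [h, endLimit_of_not_exists e h]
  rw [h1]
  exact (hE.inter hC).union (hE.compl.inter (.const _))

end

/-! ### The geometry of the dyadic Schreier graph -/

/-- Outside of a finite set, the points `γ` and `γ.g` lie in the same component of the complement
of `K`. -/
theorem exists_finite_forall_componentCompl (K : Finset DyadicVertex) (g : ThompsonF) :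
    ∃ S : Set DyadicVertex, S.Finite ∧ ∀ γ ∉ S,
      ∃ C : dyadicSchreierGraph.ComponentCompl (K : Set DyadicVertex), γ ∈ C ∧ γ.act g ∈ C := by
  classical
  obtain ⟨g, hg⟩ := g
  have himg : ∀ (S : Set DyadicVertex) (g : ThompsonF), S.Finite →
      ((DyadicVertex.actEquiv g) ⁻¹' S).Finite := fun S g hS =>
    hS.preimage (DyadicVertex.actEquiv g).injective.injOn
  induction hg using Subgroup.closure_induction with
  | mem g hg =>
    set s : ThompsonF := ⟨g, Subgroup.subset_closure hg⟩
    refine ⟨K ∪ (DyadicVertex.actEquiv s) ⁻¹' K, K.finite_toSet.union (himg _ s K.finite_toSet),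
      fun γ hγ => ?_⟩
    simp only [Set.mem_union, not_or, Set.mem_preimage, DyadicVertex.actEquiv_apply] at hγ
    refine ⟨_, dyadicSchreierGraph.componentComplMk_mem hγ.1, ?_⟩
    -- Fixed points are treated apart, since loops are absent from the simple graph.
    rcases eq_or_ne γ (γ.act s) with h | h
    · exact Eq.subst (motive := fun v => v ∈ dyadicSchreierGraph.componentComplMk hγ.1) h
        (dyadicSchreierGraph.componentComplMk_mem hγ.1)
    · have hadj : dyadicSchreierGraph.Adj γ (γ.act s) := by
        refine (SimpleGraph.fromRel_adj _ _ _).2 ⟨h, Or.inl ⟨s, ?_, rfl⟩⟩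
        rcases hg with hg | hg
        · exact Or.inl (Subtype.ext hg)
        · exact Or.inr (Or.inl (Subtype.ext hg))
      rw [dyadicSchreierGraph.componentComplMk_eq_of_adj hγ.1 hγ.2 hadj]
      exact dyadicSchreierGraph.componentComplMk_mem hγ.2
  | one =>
    exact ⟨K, K.finite_toSet, fun γ hγ => ⟨_, dyadicSchreierGraph.componentComplMk_mem hγ,
      dyadicSchreierGraph.componentComplMk_mem hγ⟩⟩
  | mul a b ha hb iha ihb =>
    obtain ⟨S, hS, h1⟩ := iha
    obtain ⟨T, hT, h2⟩ := ihb
    refine ⟨S ∪ (DyadicVertex.actEquiv ⟨a, ha⟩) ⁻¹' T, hS.union (himg _ _ hT), fun γ hγ => ?_⟩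
    simp only [Set.mem_union, not_or] at hγ
    obtain ⟨C, hC, hC'⟩ := h1 γ hγ.1
    obtain ⟨D, hD, hD'⟩ := h2 (γ.act ⟨a, ha⟩) hγ.2
    obtain rfl := componentCompl_eq_of_mem hC' hD
    exact ⟨C, hC, hD'⟩
  | inv a ha iha =>
    obtain ⟨S, hS, h1⟩ := iha
    refine ⟨(DyadicVertex.actEquiv ⟨a, ha⟩⁻¹) ⁻¹' S, himg _ _ hS, fun γ hγ => ?_⟩
    obtain ⟨C, hC, hC'⟩ := h1 (γ.act ⟨a, ha⟩⁻¹) hγ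
    rw [← DyadicVertex.act_mul, inv_mul_cancel, DyadicVertex.act_one] at hC'
    exact ⟨C, hC', hC⟩

theorem exists_finite_forall_mem_componentCompl (K : Finset DyadicVertex) {H : Set ThompsonF}
    (hH : H.Finite) : ∃ S : Set DyadicVertex, S.Finite ∧ ∀ γ ∉ S, ∀ h ∈ H,
      ∃ C : dyadicSchreierGraph.ComponentCompl (K : Set DyadicVertex), γ ∈ C ∧ γ.act h ∈ C := by
  choose S hS h using exists_finite_forall_componentCompl K
  refine ⟨⋃ g ∈ H, S g, hH.biUnion fun g _ => hS g, fun γ hγ g hg => h g γ fun hmem => hγ ?_⟩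
  exact Set.mem_biUnion hg hmem

/-- A transient sequence with steps from a finite set converges to an end. -/
theorem exists_convergesToEnd_of_transient {H : Set ThompsonF} (hH : H.Finite)
    {x : ℕ → ThompsonF} (hx : ∀ n, ∃ h ∈ H, x (n + 1) = x n * h) {γ : DyadicVertex}
    (hγ : ∀ S : Set DyadicVertex, S.Finite → ∀ᶠ n in atTop, γ.act (x n) ∉ S) :
    ∃ ω, ConvergesToEnd dyadicSchreierGraph (fun n => γ.act (x n)) ω := by
  refine exists_convergesToEnd_iff.2 fun K => ?_
  obtain ⟨S, hS, h⟩ := exists_finite_forall_mem_componentCompl K hH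
  obtain ⟨N, hN⟩ := eventually_atTop.1 (hγ S hS)
  have hstep : ∀ n ≥ N, ∃ C : dyadicSchreierGraph.ComponentCompl (K : Set DyadicVertex),
      γ.act (x n) ∈ C ∧ γ.act (x (n + 1)) ∈ C := fun n hn => by
    obtain ⟨s, hs, hxs⟩ := hx n
    rw [hxs]
    exact h _ (hN n hn) s hs
  obtain ⟨C, hC, -⟩ := hstep N le_rfl
  refine ⟨C, eventually_atTop.2 ⟨N, fun n hn => ?_⟩⟩
  induction n, hn using Nat.le_induction with
  | base => exact hC
  | succ n hn ih =>
    obtain ⟨D, hD, hD'⟩ := hstep n hn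
    obtain rfl := componentCompl_eq_of_mem hD ih
    exact hD'

/-! ### The cut vertex 1/2 and its two infinite sides -/

/-- The vertices of the branch of the dyadic Schreier graph at `1 / 4`. -/
def quarterBranch : Set DyadicVertex := {γ | ∃ (k : ℤ) (n : ℕ), γ.1 = (4 * k + 1) / 2 ^ (n + 2)}

/-- The vertex `1 / 2`. -/
def halfVertex : DyadicVertex := ⟨1 / 2, 1, 1, by norm_num⟩

theorem mem_quarterBranch_act_A_iff (γ : DyadicVertex) :
    γ.act ThompsonF.A ∈ quarterBranch ↔ γ ∈ quarterBranch := by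
  constructor
  · rintro ⟨k, n, h⟩
    rw [DyadicVertex.coe_act_A] at h
    refine ⟨k + 2 ^ n, n, ?_⟩
    rw [← sub_add_cancel γ.1 1, h]
    push_cast
    field_simp
    ring
  · rintro ⟨k, n, h⟩
    refine ⟨k - 2 ^ n, n, ?_⟩
    rw [DyadicVertex.coe_act_A, h]
    push_cast
    field_simp
    ring

/-- Halving keeps the numerator modulo 4 and raises the exponent of the denominator. It can enter
the branch only at the minimal exponent 2, from a point (4k+1)/2 in (0,2], which forces 1/2. -/
theorem mem_quarterBranch_act_B_iff {γ : DyadicVertex} (hγ : γ ≠ halfVertex) :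
    γ.act ThompsonF.B ∈ quarterBranch ↔ γ ∈ quarterBranch := by
  by_cases h0 : γ.1 ≤ 0
  · have : γ.act ThompsonF.B = γ := Subtype.ext (by rw [DyadicVertex.coe_act_B, if_pos h0])
    rw [this]
  by_cases h2 : γ.1 ≤ 2
  · have h : (γ.act ThompsonF.B).1 = γ.1 / 2 := by
      rw [DyadicVertex.coe_act_B, if_neg h0, if_pos h2]
    constructor
    · rintro ⟨k, n, hk⟩
      rw [h] at hk
      cases n with
      | zero =>
        exfalso
        have hγk : γ.1 = (4 * k + 1) / 2 := by linarith
        have hk0 : (-1 : ℝ) < k := by linarith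
        have hk1 : (k : ℝ) < 1 := by linarith
        have hk2 : k = 0 := by
          have h3 : (-1 : ℤ) < k := by exact_mod_cast hk0
          have h4 : k < 1 := by exact_mod_cast hk1
          omega
        refine hγ (Subtype.ext ?_)
        rw [hγk, hk2]
        norm_num [halfVertex]
      | succ n =>
        refine ⟨k, n, ?_⟩
        rw [← div_mul_cancel₀ γ.1 (two_ne_zero), hk]
        field_simp
        ring
    · rintro ⟨k, n, hk⟩
      refine ⟨k, n + 1, ?_⟩
      rw [h, hk]
      field_simp
      ring
  · have : γ.act ThompsonF.B = γ.act ThompsonF.A := Subtype.ext (by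
      rw [DyadicVertex.coe_act_B, if_neg h0, if_neg h2, DyadicVertex.coe_act_A])
    rw [this, mem_quarterBranch_act_A_iff]

theorem mem_quarterBranch_iff_of_act_eq {γ γ' : DyadicVertex} (hγ : γ ≠ halfVertex)
    (hγ' : γ' ≠ halfVertex)
    (h : ∃ s ∈ ({ThompsonF.A, ThompsonF.B, ThompsonF.A⁻¹, ThompsonF.B⁻¹} : Set ThompsonF),
      γ.act s = γ') : γ ∈ quarterBranch ↔ γ' ∈ quarterBranch := by
  have hinv : ∀ s : ThompsonF, γ.act s⁻¹ = γ' → γ'.act s = γ := by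
    rintro s rfl
    rw [← DyadicVertex.act_mul, inv_mul_cancel, DyadicVertex.act_one]
  obtain ⟨s, rfl | rfl | rfl | rfl, h⟩ := h
  · rw [← h, mem_quarterBranch_act_A_iff]
  · rw [← h, mem_quarterBranch_act_B_iff hγ]
  · rw [← hinv _ h, mem_quarterBranch_act_A_iff]
  · rw [← hinv _ h, mem_quarterBranch_act_B_iff hγ']

/-- Removing the vertex `1 / 2` disconnects `quarterBranch` from the rest of the graph. -/
theorem mem_quarterBranch_iff_of_mem_componentCompl
    {C : dyadicSchreierGraph.ComponentCompl (({halfVertex} : Finset DyadicVertex) :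
      Set DyadicVertex)} {γ γ' : DyadicVertex} (h : γ ∈ C) (h' : γ' ∈ C) :
    γ ∈ quarterBranch ↔ γ' ∈ quarterBranch := by
  let f : dyadicSchreierGraph.ComponentCompl (({halfVertex} : Finset DyadicVertex) :
      Set DyadicVertex) → Prop :=
    SimpleGraph.ComponentCompl.lift (fun v _ => v ∈ quarterBranch) fun v w hv hw hadj => by
      simp only [Finset.coe_singleton, Set.mem_singleton_iff] at hv hw
      rcases ((SimpleGraph.fromRel_adj _ _ _).1 hadj).2 with h | h
      · exact propext (mem_quarterBranch_iff_of_act_eq hv hw h)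
      · exact propext (mem_quarterBranch_iff_of_act_eq hw hv h).symm
  have hf : ∀ v ∈ C, f C = (v ∈ quarterBranch) := by
    rintro v ⟨hv, rfl⟩
    rfl
  rw [← hf γ h, ← hf γ' h']

theorem infinite_unitDyadics_inter_of_forall (T : Set DyadicVertex) (a : ℕ) (ha0 : 0 < a)
    (ha : a < 4) (hT : ∀ (γ : DyadicVertex) (n : ℕ), γ.1 = a / 2 ^ (n + 2) → γ ∈ T) :
    (unitDyadics ∩ T).Infinite := by
  let v : ℕ → DyadicVertex := fun n => ⟨a / 2 ^ (n + 2), a, n + 2, by push_cast; rfl⟩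
  have ha' : (0 : ℝ) < a := by exact_mod_cast ha0
  have ha4 : (a : ℝ) < 4 := by exact_mod_cast ha
  refine Set.infinite_of_injective_forall_mem (f := v) (fun m n h => ?_) fun n => ⟨⟨?_, ?_⟩, ?_⟩
  · have h1 : (a : ℝ) / 2 ^ (m + 2) = a / 2 ^ (n + 2) := congrArg Subtype.val h
    rw [div_eq_div_iff (by positivity) (by positivity)] at h1
    replace h1 := (mul_left_cancel₀ ha'.ne' h1).symm
    have := pow_right_injective₀ (by norm_num : (0 : ℝ) < 2) (by norm_num) h1
    omega
  · change (0 : ℝ) < a / 2 ^ (n + 2)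
    positivity
  · change (a : ℝ) / 2 ^ (n + 2) < 1
    rw [div_lt_one (by positivity), pow_add]
    have : (1 : ℝ) ≤ 2 ^ n := one_le_pow₀ (by norm_num)
    linarith
  · exact hT _ n rfl

theorem infinite_unitDyadics_inter_quarterBranch : (unitDyadics ∩ quarterBranch).Infinite :=
  infinite_unitDyadics_inter_of_forall _ 1 one_pos (by norm_num) fun γ n h =>
    ⟨0, n, by rw [h]; norm_num⟩

theorem infinite_unitDyadics_inter_compl_quarterBranch :
    (unitDyadics ∩ quarterBranchᶜ).Infinite := by
  refine infinite_unitDyadics_inter_of_forall _ 3 three_pos (by norm_num) fun γ n h => ?_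
  rintro ⟨k, m, hk⟩
  rw [h, div_eq_div_iff (by positivity) (by positivity)] at hk
  have h1 : (3 : ℤ) * 2 ^ (m + 2) = (4 * k + 1) * 2 ^ (n + 2) := by exact_mod_cast hk
  rcases lt_trichotomy m n with hmn | rfl | hmn
  · obtain ⟨d, rfl⟩ := Nat.exists_eq_add_of_lt hmn
    have h2 : (3 : ℤ) = (4 * k + 1) * 2 ^ (d + 1) := by
      refine mul_right_cancel₀ (b := (2 : ℤ) ^ (m + 2)) (by positivity) ?_
      rw [h1]
      ring
    rw [pow_succ] at h2
    have : (2 : ℤ) ∣ 3 := ⟨(4 * k + 1) * 2 ^ d, by rw [h2]; ring⟩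
    omega
  · have h2 := mul_right_cancel₀ (by positivity) h1
    omega
  · obtain ⟨d, rfl⟩ := Nat.exists_eq_add_of_lt hmn
    have h2 : (3 : ℤ) * 2 ^ (d + 1) = 4 * k + 1 := by
      refine mul_right_cancel₀ (b := (2 : ℤ) ^ (n + 2)) (by positivity) ?_
      rw [← h1]
      ring
    rw [pow_succ] at h2
    omega

/-! ### The limit end field -/

/-- The end field of the limits of a path in `F̃`. -/
def limitEndField (e : EndSpace dyadicSchreierGraph) (x : ℕ → ThompsonF) : EndField :=
  fun γ => endLimit e fun n => γ.act (x n)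

theorem measurable_limitEndField (e : EndSpace dyadicSchreierGraph) :
    Measurable (limitEndField e) :=
  measurable_pi_iff.2 fun γ => measurable_endLimit e fun n S => measurableSet_act_mem γ n S

theorem limitEndField_timeShift (e : EndSpace dyadicSchreierGraph) (x : ℕ → ThompsonF) :
    limitEndField e (timeShift x) = limitEndField e x :=
  funext fun γ => endLimit_shift e fun n => γ.act (x n)

theorem limitEndField_mul_left (e : EndSpace dyadicSchreierGraph) (g : ThompsonF)
    (x : ℕ → ThompsonF) : (limitEndField e fun n => g * x n) = g • limitEndField e x := rfl

instance EndField.instStandardBorelSpace : StandardBorelSpace EndField :=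
  inferInstanceAs (StandardBorelSpace (DyadicVertex → EndSpace dyadicSchreierGraph))

/-- Equivariance holds for every path: γ.(g x_n) = (γ.g).x_n, and the default end `e` is the same at
all vertices. -/
theorem isMuBoundary_map_limitEndField (μ : PMF ThompsonF) (e : EndSpace dyadicSchreierGraph) :
    IsMuBoundary μ ((pathMeasure μ).map (limitEndField e)) where
  standardBorel := inferInstance
  measurable_smul g := measurable_pi_iff.2 fun γ => measurable_pi_apply (γ.act g)
  exists_quotient := by
    have hp : Measurable[MeasurableSpace.invariants timeShift] (limitEndField e) := by
      refine MeasurableSpace.measurable_invariants_dom.2 ⟨measurable_limitEndField e, fun s _ => ?_⟩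
      rw [show limitEndField e ∘ timeShift = limitEndField e from
        funext (limitEndField_timeShift e)]
    refine ⟨limitEndField e, hp, fun g => Eventually.of_forall fun ξ => rfl, ?_⟩
    have hq : Measurable (toPoissonBoundary : (ℕ → ThompsonF) → PoissonBoundary ThompsonF) :=
      fun s hs => MeasurableSpace.invariants_le (α := ℕ → ThompsonF) timeShift s hs
    exact Measure.map_map (μ := pathMeasure μ) (g := limitEndField e) hp hq

/-! ### Almost sure convergence and incompatibility with a constant end -/

theorem ae_exists_convergesToEnd (μ : PMF ThompsonF) (hfin : μ.support.Finite)
    (hnd : StrictlyNondegenerate μ) : ∀ᵐ g ∂(pathMeasure μ), ∀ γ : DyadicVertex,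
      ∃ ω, ConvergesToEnd dyadicSchreierGraph (fun n => γ.act (g n)) ω := by
  filter_upwards [ae_eventually_act_notMem μ hfin hnd, ae_pathMeasure_step μ] with g h1 h2 γ
  exact exists_convergesToEnd_of_transient hfin h2 (h1 γ)

/-- The walks from far away points in a side of a finite set `K` of vertices stay in that side with
positive probability. -/
theorem exists_mem_component_of_ae_convergesToEnd (μ : PMF ThompsonF) (hfin : μ.support.Finite)
    (hnd : StrictlyNondegenerate μ) {ω : EndSpace dyadicSchreierGraph}
    (hω : ∀ᵐ g ∂(pathMeasure μ), ∀ γ : DyadicVertex,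
      ConvergesToEnd dyadicSchreierGraph (fun n => γ.act (g n)) ω) (K : Finset DyadicVertex)
    {T : Set DyadicVertex} (hT : (unitDyadics ∩ T).Infinite)
    (hK : ∀ C : dyadicSchreierGraph.ComponentCompl (K : Set DyadicVertex), ∀ γ ∈ C, ∀ γ' ∈ C,
      γ ∈ T → γ' ∈ T) : ∃ γ ∈ ω.component K, γ ∈ T := by
  -- Off S, no step from the support changes the component of the complement of K, so a walk
  -- avoiding S forever never leaves T.
  obtain ⟨S, hS, hstep⟩ := exists_finite_forall_mem_componentCompl K hfin
  obtain ⟨γ, ⟨hγU, hγT⟩, hγ⟩ :=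
    (hT.sdiff (finite_pathMeasure_avoid_eq_zero μ hfin hnd hS)).nonempty
  have hpos : ∃ᵐ g ∂(pathMeasure μ), ∀ n, γ.act (g n) ∉ S :=
    frequently_ae_iff.2 fun h => hγ ⟨hγU, h⟩
  obtain ⟨g, havoid, hconv, h0, hg⟩ := (hpos.and_eventually
    (hω.and ((ae_pathMeasure_zero μ).and (ae_pathMeasure_step μ)))).exists
  have hmem : ∀ n, γ.act (g n) ∈ T := fun n => by
    induction n with
    | zero => rwa [h0, DyadicVertex.act_one]
    | succ n ih =>
      obtain ⟨h, hh, hgn⟩ := hg n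
      obtain ⟨C, hC, hC'⟩ := hstep _ (havoid n) h hh
      rw [hgn]
      exact hK C _ hC _ hC' ih
  obtain ⟨n, hn⟩ := (hconv γ K).exists
  exact ⟨_, hn, hmem n⟩

theorem not_ae_convergesToEnd_const (μ : PMF ThompsonF) (hfin : μ.support.Finite)
    (hnd : StrictlyNondegenerate μ) (ω : EndSpace dyadicSchreierGraph) :
    ¬ ∀ᵐ g ∂(pathMeasure μ), ∀ γ : DyadicVertex,
      ConvergesToEnd dyadicSchreierGraph (fun n => γ.act (g n)) ω := by
  intro hω
  obtain ⟨γ, hγ, h⟩ := exists_mem_component_of_ae_convergesToEnd μ hfin hnd hω {halfVertex}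
    infinite_unitDyadics_inter_quarterBranch fun C γ hγ γ' hγ' =>
      (mem_quarterBranch_iff_of_mem_componentCompl hγ hγ').1
  obtain ⟨γ', hγ', h'⟩ := exists_mem_component_of_ae_convergesToEnd μ hfin hnd hω {halfVertex}
    infinite_unitDyadics_inter_compl_quarterBranch fun C γ hγ γ' hγ' =>
      mt (mem_quarterBranch_iff_of_mem_componentCompl hγ hγ').2
  exact h' ((mem_quarterBranch_iff_of_mem_componentCompl hγ hγ').1 h)

/-! ### Transitivity and non-triviality of the boundary -/

theorem DyadicVertex.coe_act_B_inv (γ : DyadicVertex) : (γ.act ThompsonF.B⁻¹).1 =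
    if γ.1 ≤ 0 then γ.1 else if γ.1 ≤ 1 then 2 * γ.1 else γ.1 + 1 := rfl

/-- Translate into (0,1], where `B⁻¹` doubles and thus lowers the exponent of the denominator;
exponent zero is an integer, which a translation sends to 0. -/
theorem DyadicVertex.exists_act_eq_zero (k : ℤ) (n : ℕ) {γ : DyadicVertex}
    (hγ : γ.1 = k / 2 ^ n) : ∃ g, (γ.act g).1 = 0 := by
  induction n generalizing k γ with
  | zero =>
    obtain ⟨g, hg⟩ := γ.exists_act_eq_sub_int k
    exact ⟨g, by rw [hg, hγ, pow_zero, div_one, sub_self]⟩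
  | succ n ih =>
    obtain ⟨g, hg⟩ := γ.exists_act_eq_sub_int (⌈γ.1⌉ - 1)
    have h1 := Int.le_ceil γ.1
    have h2 := Int.ceil_lt_add_one γ.1
    push_cast at hg
    have hB : ((γ.act g).act ThompsonF.B⁻¹).1 = 2 * (γ.act g).1 := by
      rw [DyadicVertex.coe_act_B_inv, if_neg (by linarith), if_pos (by linarith)]
    obtain ⟨g', hg'⟩ := ih (k - 2 * (⌈γ.1⌉ - 1) * 2 ^ n) (γ := (γ.act g).act ThompsonF.B⁻¹) (by
      rw [hB, hg]
      push_cast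
      rw [sub_div, mul_div_cancel_right₀ _ (by positivity), mul_sub, hγ, pow_succ]
      field_simp)
    exact ⟨g * ThompsonF.B⁻¹ * g', hg'⟩

/-- The group `F̃` acts transitively on the dyadic rationals. -/
theorem DyadicVertex.exists_act_eq (γ γ' : DyadicVertex) : ∃ g, γ.act g = γ' := by
  obtain ⟨k, n, hγ⟩ := γ.2
  obtain ⟨k', n', hγ'⟩ := γ'.2
  obtain ⟨g, hg⟩ := exists_act_eq_zero k n hγ
  obtain ⟨g', hg'⟩ := exists_act_eq_zero k' n' hγ'
  refine ⟨g * g'⁻¹, ?_⟩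
  rw [act_mul, show γ.act g = γ'.act g' from Subtype.ext (hg.trans hg'.symm), ← act_mul,
    mul_inv_cancel, act_one]

/-- If the limit end field is almost surely constant, then it is a constant function. -/
theorem apply_eq_of_ae_limitEndField_eq (μ : PMF ThompsonF) (hnd : StrictlyNondegenerate μ)
    {e : EndSpace dyadicSchreierGraph} {φ : EndField}
    (h : ∀ᵐ x ∂(pathMeasure μ), limitEndField e x = φ) (γ γ' : DyadicVertex) : φ γ' = φ γ := by
  have hfix : ∀ g : ThompsonF, g • φ = φ := fun g => by
    have hg : g ∈ Subsemigroup.closure μ.support := by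
      rw [show Subsemigroup.closure μ.support = ⊤ from hnd]
      exact Subsemigroup.mem_top g
    induction hg using Subsemigroup.closure_induction with
    | mem g hg =>
      -- Shift invariance lets the Markov property compare the walk with its translate by g: both
      -- limit fields equal φ, so g • φ = φ.
      have h1 : ∀ᵐ x ∂(pathMeasure μ), limitEndField e (timeShift x) = φ := by
        filter_upwards [h] with x hx
        rw [limitEndField_timeShift, hx]
      have h2 := ae_pathMeasure_of_ae_timeShift μ h1
        (measurable_limitEndField e (measurableSet_singleton φ)) hg
      obtain ⟨x, hx, hgx⟩ := (h.and h2).exists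
      rw [limitEndField_mul_left, hx] at hgx
      exact hgx
    | mul a b _ _ ha hb => rw [mul_smul, hb, ha]
  obtain ⟨g, rfl⟩ := γ.exists_act_eq γ'
  exact congrFun (hfix g) γ

theorem not_isPointMeasure_map_limitEndField (μ : PMF ThompsonF) (hfin : μ.support.Finite)
    (hnd : StrictlyNondegenerate μ) (e : EndSpace dyadicSchreierGraph) :
    ¬ IsPointMeasure ((pathMeasure μ).map (limitEndField e)) := by
  rintro ⟨φ, hφ⟩
  have h : ∀ᵐ x ∂(pathMeasure μ), limitEndField e x = φ := by
    refine ae_of_ae_map (measurable_limitEndField e).aemeasurable (p := fun ψ => ψ = φ) ?_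
    rw [hφ, ae_dirac_eq]
    exact rfl
  refine not_ae_convergesToEnd_const μ hfin hnd (φ halfVertex) ?_
  filter_upwards [h, ae_exists_convergesToEnd μ hfin hnd] with x hx hconv γ
  rw [← apply_eq_of_ae_limitEndField_eq μ hnd h halfVertex γ, ← hx]
  exact convergesToEnd_endLimit e (hconv γ)

end

theorem mainTheorem2 (μ : PMF ThompsonF) (hfin : μ.support.Finite)
    (hnd : StrictlyNondegenerate μ) :
    (∀ᵐ g ∂(pathMeasure μ), ∀ γ : DyadicVertex,
      ∃! ω : EndSpace dyadicSchreierGraph,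
        ConvergesToEnd dyadicSchreierGraph (fun n => γ.act (g n)) ω) ∧
    ∃ Ω : (ℕ → ThompsonF) → EndField,
      Measurable Ω ∧
      (∀ᵐ g ∂(pathMeasure μ), ∀ γ : DyadicVertex,
        ConvergesToEnd dyadicSchreierGraph (fun n => γ.act (g n)) (Ω g γ)) ∧
      IsMuBoundary μ ((pathMeasure μ).map Ω) ∧
      ¬ IsPointMeasure ((pathMeasure μ).map Ω) := by
  have hconv := ae_exists_convergesToEnd μ hfin hnd
  -- An almost sure event is nonempty, so some path supplies an end to serve as default value.
  obtain ⟨e, -⟩ := hconv.exists.choose_spec halfVertex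
  refine ⟨?_, limitEndField e, measurable_limitEndField e, ?_,
    isMuBoundary_map_limitEndField μ e, not_isPointMeasure_map_limitEndField μ hfin hnd e⟩
  · filter_upwards [hconv] with g hg γ
    obtain ⟨ω, hω⟩ := hg γ
    exact ⟨ω, hω, fun ω' hω' => hω'.unique hω⟩
  · filter_upwards [hconv] with g hg γ
    exact convergesToEnd_endLimit e (hg γ)
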